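/- Let $W$ be a finite-dimensional complex vector space, let $Q$ be a non-degenerate alternating bilinear form on $W$, and let $Sp(W)=Sp(W,Q)$ be the group of linear automorphisms of $W$ preserving $Q$. Let $n\ge 0$ be an integer with $n\le \dim W-1$, let $V=\wedge^n W$, and let $\rho\colon Sp(W)\to \mathrm{Aut}(V)$ be the natural action, $\rho(h)(w_1\wedge\cdots\wedge w_n)=hw_1\wedge\cdots\wedge hw_n$. Suppose that $g\in \mathrm{Aut}(V)$ normalizes the image of $Sp(W)$, i.e. $g\,\rho(Sp(W))\,g^{-1}=\rho(Sp(W))$. Then every linear subspace $U\subseteq V$ that is $Sp(W)$-invariant (i.e. $\rho(h)U\subseteq U$ for all $h\in Sp(W)$) is also $g$-invariant: $gU=U$. -/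

import Mathlib

/-- The symplectic group `Sp(W, Q)`: the linear automorphisms of `W` that preserve the bilinear
form `Q` (which is non-degenerate and alternating where this is used). -/
def symplecticSubgroup {W : Type*} [AddCommGroup W] [Module ℂ W]
    (Q : LinearMap.BilinForm ℂ W) : Subgroup (W ≃ₗ[ℂ] W) where
  carrier := {f | ∀ x y : W, Q (f x) (f y) = Q x y}
  mul_mem' := by
    intro f g hf hg x y
    exact (hf (g x) (g y)).trans (hg x y)
  one_mem' := fun _ _ => rfl
  inv_mem' := by
    intro f hf x y
    have h := hf (f.symm x) (f.symm y)
    rw [f.apply_symm_apply, f.apply_symm_apply] at h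
    exact h.symm

/-- The natural action of `GL(W)` on the `n`-th exterior power, as a group homomorphism
`GL(W) → GL(⋀ⁿ W)`; it satisfies `f (w₁ ∧ ⋯ ∧ wₙ) = f w₁ ∧ ⋯ ∧ f wₙ`. -/
noncomputable def exteriorPowerRep (W : Type*) [AddCommGroup W] [Module ℂ W] (n : ℕ) :
    (W ≃ₗ[ℂ] W) →* (⋀[ℂ]^n W ≃ₗ[ℂ] ⋀[ℂ]^n W) where
  toFun f := LinearEquiv.ofLinearMap
    (exteriorPower.map n (f : W →ₗ[ℂ] W)) (exteriorPower.map n (f.symm : W →ₗ[ℂ] W))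
    (by rw [← exteriorPower.map_comp, LinearEquiv.comp_symm, exteriorPower.map_id])
    (by rw [← exteriorPower.map_comp, LinearEquiv.symm_comp, exteriorPower.map_id])
  map_one' := LinearEquiv.toLinearMap_injective exteriorPower.map_id
  map_mul' f g := LinearEquiv.toLinearMap_injective
    (exteriorPower.map_comp (g : W →ₗ[ℂ] W) (f : W →ₗ[ℂ] W))

/-! Let 𝔤 ⊆ End V be the span of the derivations D_v induced by x ↦ Q(v, x) v
(`symplecticDerivations`). It is the image of the symplectic Lie algebra; D_v² = 0, and a
transvection acts on V as 1 + D_v. The theorem follows from two facts: the projection onto an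
invariant subspace is a polynomial in the Casimir operator C of 𝔤, and g commutes with C.

Commutant. On ⋀ⁿ W, C is 8LΛ plus a scalar, with L and Λ the Lefschetz operators
(`toAlgebra_casimir`). Let w be a product of bivectors eᵢ ∧ fᵢ, i ∈ K, and at most one further eⱼ.
It generates V under 𝔤 (`wedgeBasis_mem_of_card`), so an endomorphism T commuting with 𝔤 is
determined by Tw. Now Tw satisfies the linear equations that certain elements of 𝔤 impose on w, and
their solutions are spanned by the vectors (LΛ)^d w (`pairInvariants_le`). Hence T is a polynomial
in C (`exists_aeval_casimir_eq`), and the commutant is commutative.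

Projection. For the Hermitian form with orthonormal monomials, 𝔤 is closed under adjoints
(`adjoint_mem`), so the orthogonal projection onto an invariant U commutes with 𝔤.

Normalizer. The trace form is tr(D_v D_w) = κ Q(v, w)² (`exists_trace_eq`). If κ = 0, positivity
gives 𝔤 = 0 and C = 0. If κ ≠ 0, C is determined by 𝔤 and the trace form, so it is fixed by
conjugations preserving 𝔤 (`casimir_fixed`). That g preserves 𝔤 is derived from its normalizing the
group: X = g D_v g⁻¹ is square-zero and 1 + X is the action of a symplectic map, so [X, 𝔤] ⊆ 𝔤, and
`mem_of_sq_eq_zero_of_normalizes` gives X ∈ 𝔤. -/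

open CliffordAlgebra (contractLeft)

namespace SymplecticExterior

/-! ### Creation and annihilation operators on the exterior algebra. -/

section Operators

variable {W : Type*} [AddCommGroup W] [Module ℂ W]

/-- Exterior multiplication by a vector. -/
noncomputable def create : W →ₗ[ℂ] Module.End ℂ (ExteriorAlgebra ℂ W) :=
  (LinearMap.mul ℂ (ExteriorAlgebra ℂ W)) ∘ₗ ExteriorAlgebra.ι ℂ

/-- Contraction with a linear form. -/
noncomputable def annihilate : Module.Dual ℂ W →ₗ[ℂ] Module.End ℂ (ExteriorAlgebra ℂ W) :=
  contractLeft

lemma create_apply (v : W) (z : ExteriorAlgebra ℂ W) :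
    create v z = ExteriorAlgebra.ι ℂ v * z := rfl

lemma annihilate_create (φ : Module.Dual ℂ W) (v : W) (z : ExteriorAlgebra ℂ W) :
    annihilate φ (create v z) = φ v • z - create v (annihilate φ z) :=
  CliffordAlgebra.contractLeft_ι_mul φ v z

lemma annihilate_algebraMap (φ : Module.Dual ℂ W) (r : ℂ) :
    annihilate φ (algebraMap ℂ (ExteriorAlgebra ℂ W) r) = 0 :=
  CliffordAlgebra.contractLeft_algebraMap _ φ r

lemma annihilate_anticomm (φ ψ : Module.Dual ℂ W) (z : ExteriorAlgebra ℂ W) :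
    annihilate φ (annihilate ψ z) = -annihilate ψ (annihilate φ z) :=
  CliffordAlgebra.contractLeft_comm φ ψ z

lemma create_anticomm (v w : W) (z : ExteriorAlgebra ℂ W) :
    create v (create w z) = -create w (create v z) := by
  have h := ExteriorAlgebra.ι_add_mul_swap (R := ℂ) v w
  rw [create_apply, create_apply, create_apply, create_apply, ← mul_assoc, ← mul_assoc,
    eq_neg_of_add_eq_zero_left h, neg_mul]

lemma create_create_self (v : W) (z : ExteriorAlgebra ℂ W) : create v (create v z) = 0 := by
  rw [create_apply, create_apply, ← mul_assoc, ExteriorAlgebra.ι_sq_zero, zero_mul]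

/-- An induction principle that builds elements of the exterior algebra by multiplication by
vectors from the left. -/
lemma create_induction {p : ExteriorAlgebra ℂ W → Prop}
    (h0 : ∀ r, p (algebraMap ℂ _ r)) (hadd : ∀ x y, p x → p y → p (x + y))
    (hmul : ∀ x v, p x → p (create v x)) (z : ExteriorAlgebra ℂ W) : p z :=
  CliffordAlgebra.left_induction (Q := (0 : QuadraticForm ℂ W)) h0 hadd hmul z

lemma map_create (f : W →ₗ[ℂ] W) (v : W) (z : ExteriorAlgebra ℂ W) :
    ExteriorAlgebra.map f (create v z) = create (f v) (ExteriorAlgebra.map f z) := by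
  rw [create_apply, map_mul, ExteriorAlgebra.map_apply_ι, create_apply]

lemma map_annihilate (f : W →ₗ[ℂ] W) (φ : Module.Dual ℂ W) (z : ExteriorAlgebra ℂ W) :
    ExteriorAlgebra.map f (annihilate (φ ∘ₗ f) z) = annihilate φ (ExteriorAlgebra.map f z) := by
  induction z using create_induction with
  | h0 r => rw [annihilate_algebraMap, map_zero, AlgHom.commutes, annihilate_algebraMap]
  | hadd x y hx hy => simp only [map_add, hx, hy]
  | hmul x v hx =>
    rw [annihilate_create, map_sub, map_smul, map_create, map_create, hx, annihilate_create]
    rfl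

/-- The map induced by a transvection differs from the identity by a rank one derivation. -/
lemma map_transvection (v : W) (φ : Module.Dual ℂ W) (f : W →ₗ[ℂ] W)
    (hf : ∀ x, f x = x + φ x • v) (z : ExteriorAlgebra ℂ W) :
    ExteriorAlgebra.map f z = z + create v (annihilate φ z) := by
  induction z using create_induction with
  | h0 r => rw [annihilate_algebraMap, map_zero, AlgHom.commutes, add_zero]
  | hadd x y hx hy => simp only [map_add, hx, hy]; abel
  | hmul x u hx =>
    rw [map_create, hx, annihilate_create, hf]
    simp only [map_add, map_sub, map_smul, LinearMap.add_apply, LinearMap.smul_apply,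
      create_create_self, smul_zero, add_zero]
    rw [create_anticomm v u]
    abel

lemma create_mem_exteriorPower (v : W) {n : ℕ} {z : ExteriorAlgebra ℂ W}
    (hz : z ∈ ⋀[ℂ]^n W) : create v z ∈ ⋀[ℂ]^(n + 1) W := by
  rw [ExteriorAlgebra.exteriorPower, pow_succ']
  exact Submodule.mul_mem_mul (LinearMap.mem_range_self _ v) hz

lemma create_annihilate_mem (v : W) (φ : Module.Dual ℂ W) (n : ℕ) :
    ∀ z ∈ ⋀[ℂ]^n W, create v (annihilate φ z) ∈ ⋀[ℂ]^n W := by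
  induction n with
  | zero =>
    intro z hz
    rw [ExteriorAlgebra.exteriorPower, pow_zero, Submodule.mem_one] at hz
    obtain ⟨r, rfl⟩ := hz
    rw [annihilate_algebraMap, map_zero]
    exact zero_mem _
  | succ n ih =>
    intro z hz
    rw [ExteriorAlgebra.exteriorPower, pow_succ'] at hz
    induction hz using Submodule.mul_induction_on' with
    | mem_mul_mem m hm z hz =>
      obtain ⟨u, rfl⟩ := hm
      change create v (annihilate φ (create u z)) ∈ _
      rw [annihilate_create, map_sub, map_smul, create_anticomm v u, sub_neg_eq_add]
      exact add_mem (Submodule.smul_mem _ _ (create_mem_exteriorPower v hz))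
        (create_mem_exteriorPower u (ih z hz))
    | add x _ y _ hx hy =>
      simp only [map_add]
      exact add_mem hx hy

lemma exteriorPower_map_coe {n : ℕ} (f : W →ₗ[ℂ] W) (z : ⋀[ℂ]^n W) :
    (exteriorPower.map n f z : ExteriorAlgebra ℂ W) = ExteriorAlgebra.map f z := by
  suffices h : (⋀[ℂ]^n W).subtype ∘ₗ exteriorPower.map n f =
      (ExteriorAlgebra.map f).toLinearMap ∘ₗ (⋀[ℂ]^n W).subtype from LinearMap.congr_fun h z
  ext m
  simp

lemma exteriorPowerRep_coe {n : ℕ} (f : W ≃ₗ[ℂ] W) (z : ⋀[ℂ]^n W) :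
    (exteriorPowerRep W n f z : ExteriorAlgebra ℂ W) =
      ExteriorAlgebra.map (f : W →ₗ[ℂ] W) z :=
  exteriorPower_map_coe _ z

end Operators

/-! ### The symplectic Lie algebra and the transvections acting on ⋀ⁿ W. -/

section Symplectic

/-! The `n`-th exterior power enters through a linear equivalence `e` with an arbitrary module
`V`, so that the module structure on `V` is an ordinary instance. -/

variable {W : Type*} [AddCommGroup W] [Module ℂ W] (Q : LinearMap.BilinForm ℂ W) {n : ℕ}
  {V : Type*} [AddCommGroup V] [Module ℂ V] (e : V ≃ₗ[ℂ] ⋀[ℂ]^n W)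

/-- The inclusion of `V ≃ ⋀ⁿ W` into the exterior algebra. -/
noncomputable def toAlgebra : V →ₗ[ℂ] ExteriorAlgebra ℂ W :=
  (⋀[ℂ]^n W).subtype ∘ₗ e.toLinearMap

lemma toAlgebra_injective : Function.Injective (toAlgebra e) :=
  Subtype.coe_injective.comp e.injective

lemma toAlgebra_mem (z : V) : toAlgebra e z ∈ ⋀[ℂ]^n W := (e z).2

lemma exists_toAlgebra_eq {z : ExteriorAlgebra ℂ W} (hz : z ∈ ⋀[ℂ]^n W) :
    ∃ u, toAlgebra e u = z :=
  ⟨e.symm ⟨z, hz⟩, by simp [toAlgebra]⟩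

/-- The derivation of `⋀ⁿ W` induced by the rank one endomorphism `x ↦ φ x • v`. -/
noncomputable def rankOneDerivation :
    W →ₗ[ℂ] Module.Dual ℂ W →ₗ[ℂ] Module.End ℂ V :=
  LinearMap.mk₂ ℂ
    (fun v φ => e.symm.toLinearMap ∘ₗ
      (create v * annihilate φ).restrict (create_annihilate_mem v φ n) ∘ₗ e.toLinearMap)
    (fun v w φ => by ext z; apply e.injective; ext; simp)
    (fun c v φ => by ext z; apply e.injective; ext; simp)
    (fun v φ ψ => by ext z; apply e.injective; ext; simp)
    (fun c v φ => by ext z; apply e.injective; ext; simp)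

lemma toAlgebra_rankOneDerivation (v : W) (φ : Module.Dual ℂ W) (z : V) :
    toAlgebra e (rankOneDerivation e v φ z) = create v (annihilate φ (toAlgebra e z)) := by
  simp [rankOneDerivation, toAlgebra]

/-- The action on `⋀ⁿ W` of the symmetric square of `W`, identified by `Q` with the symplectic
Lie algebra. -/
noncomputable def symDerivation : W →ₗ[ℂ] W →ₗ[ℂ] Module.End ℂ V :=
  (rankOneDerivation e).compl₂ Q + ((rankOneDerivation e).compl₂ Q).flip

/-- The derivation of `⋀ⁿ W` induced by `x ↦ Q v x • v`. -/
noncomputable def transvectionDerivation (v : W) : Module.End ℂ V :=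
  rankOneDerivation e v (Q v)

/-- The image of the symplectic Lie algebra in `End (⋀ⁿ W)`. -/
noncomputable def symplecticDerivations : Submodule ℂ (Module.End ℂ V) :=
  Submodule.span ℂ (Set.range (transvectionDerivation Q e))

lemma symDerivation_apply (v w : W) : symDerivation Q e v w =
    rankOneDerivation e v (Q w) + rankOneDerivation e w (Q v) := rfl

lemma toAlgebra_symDerivation (v w : W) (z : V) : toAlgebra e (symDerivation Q e v w z) =
    create v (annihilate (Q w) (toAlgebra e z)) + create w (annihilate (Q v) (toAlgebra e z)) := by
  rw [symDerivation_apply, LinearMap.add_apply, map_add, toAlgebra_rankOneDerivation,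
    toAlgebra_rankOneDerivation]

lemma symDerivation_comm (v w : W) : symDerivation Q e v w = symDerivation Q e w v := by
  rw [symDerivation_apply, symDerivation_apply, add_comm]

lemma symDerivation_self (v : W) :
    symDerivation Q e v v = (2 : ℂ) • transvectionDerivation Q e v := by
  rw [symDerivation_apply, two_smul]; rfl

/-- D_v is quadratic in v, with polarization `symDerivation`. Comparing coefficients of c later
determines the trace form. -/
lemma transvectionDerivation_add_smul (v w : W) (c : ℂ) :
    transvectionDerivation Q e (v + c • w) = transvectionDerivation Q e v +
      c • symDerivation Q e v w + c ^ 2 • transvectionDerivation Q e w := by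
  simp only [transvectionDerivation, symDerivation_apply, map_add, map_smul, LinearMap.add_apply,
    LinearMap.smul_apply]
  module

lemma transvectionDerivation_mem (v : W) :
    transvectionDerivation Q e v ∈ symplecticDerivations Q e :=
  Submodule.subset_span ⟨v, rfl⟩

lemma symDerivation_eq_sub (v w : W) : symDerivation Q e v w =
    transvectionDerivation Q e (v + w) - transvectionDerivation Q e v -
      transvectionDerivation Q e w := by
  have h := transvectionDerivation_add_smul Q e v w 1
  rw [one_smul] at h
  rw [h]
  module

lemma symDerivation_mem (v w : W) : symDerivation Q e v w ∈ symplecticDerivations Q e := by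
  rw [symDerivation_eq_sub]
  exact sub_mem (sub_mem (transvectionDerivation_mem Q e _) (transvectionDerivation_mem Q e _))
    (transvectionDerivation_mem Q e _)

variable {Q}

/-- The inner contraction gives Q(v, v) = 0, and what remains contains v ∧ v. The spanning elements
of 𝔤 are thus nilpotent, on which the later trace arguments rest. -/
lemma transvectionDerivation_mul_self (hQ : Q.IsAlt) (v : W) :
    transvectionDerivation Q e v * transvectionDerivation Q e v = 0 := by
  ext z
  apply toAlgebra_injective e
  rw [Module.End.mul_apply, transvectionDerivation, toAlgebra_rankOneDerivation,
    toAlgebra_rankOneDerivation, annihilate_create,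
    hQ.self_eq_zero, zero_smul, zero_sub, map_neg, create_create_self]
  simp

/-- The symplectic transvection `x ↦ x + c Q(v, x) v`. -/
noncomputable def transvection (hQ : Q.IsAlt) (v : W) (c : ℂ) : W ≃ₗ[ℂ] W :=
  LinearEquiv.ofLinearMap (LinearMap.id + (c • Q v).smulRight v)
    (LinearMap.id - (c • Q v).smulRight v)
    (by ext x; simp [hQ.self_eq_zero])
    (by ext x; simp [hQ.self_eq_zero])

lemma transvection_apply (hQ : Q.IsAlt) (v : W) (c : ℂ) (x : W) :
    transvection hQ v c x = x + (c * Q v x) • v := rfl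

lemma transvection_mem (hQ : Q.IsAlt) (v : W) (c : ℂ) :
    transvection hQ v c ∈ symplecticSubgroup Q := by
  intro x y
  simp only [transvection_apply, map_add, map_smul, LinearMap.add_apply, LinearMap.smul_apply,
    hQ.self_eq_zero, smul_eq_mul, mul_zero, add_zero]
  rw [← hQ.neg_eq v x]
  ring

/-- The action of `GL(W)` on `V ≃ ⋀ⁿ W`. -/
noncomputable def powerAction (f : W ≃ₗ[ℂ] W) : V ≃ₗ[ℂ] V :=
  e.trans ((exteriorPowerRep W n f).trans e.symm)

lemma toAlgebra_powerAction (f : W ≃ₗ[ℂ] W) (z : V) :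
    toAlgebra e (powerAction e f z) = ExteriorAlgebra.map (f : W →ₗ[ℂ] W) (toAlgebra e z) := by
  simp [powerAction, toAlgebra, exteriorPowerRep_coe]

lemma powerAction_transvection (hQ : Q.IsAlt) (v : W) (z : V) :
    powerAction e (transvection hQ v 1) z = z + transvectionDerivation Q e v z := by
  apply toAlgebra_injective e
  rw [toAlgebra_powerAction, map_transvection v (Q v) _ (fun x => by
    rw [LinearEquiv.coe_coe, transvection_apply, one_mul]), map_add, transvectionDerivation,
    toAlgebra_rankOneDerivation]

lemma powerAction_transvectionDerivation {f : W ≃ₗ[ℂ] W} (hf : f ∈ symplecticSubgroup Q)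
    (v : W) (z : V) :
    powerAction e f (transvectionDerivation Q e v z) =
      transvectionDerivation Q e (f v) (powerAction e f z) := by
  apply toAlgebra_injective e
  have h : Q v = Q (f v) ∘ₗ (f : W →ₗ[ℂ] W) := LinearMap.ext fun x => (hf v x).symm
  rw [toAlgebra_powerAction, transvectionDerivation, transvectionDerivation,
    toAlgebra_rankOneDerivation, toAlgebra_rankOneDerivation, toAlgebra_powerAction, map_create, h,
    map_annihilate]
  rfl

end Symplectic

/-! ### Existence of a symplectic basis. -/

section SymplecticBasis

variable {W : Type*} [AddCommGroup W] [Module ℂ W]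

/-- The sign attached to a vector of a symplectic basis. -/
def basisSign {ι : Type*} : ι ⊕ ι → ℂ := Sum.elim (fun _ => 1) (fun _ => -1)

@[simp] lemma basisSign_inl {ι : Type*} (i : ι) : basisSign (Sum.inl i : ι ⊕ ι) = 1 := rfl

@[simp] lemma basisSign_inr {ι : Type*} (i : ι) : basisSign (Sum.inr i : ι ⊕ ι) = -1 := rfl

@[simp] lemma basisSign_swap {ι : Type*} (x : ι ⊕ ι) : basisSign x.swap = -basisSign x := by
  cases x <;> simp

@[simp] lemma basisSign_mul_self {ι : Type*} (x : ι ⊕ ι) : basisSign x * basisSign x = 1 := by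
  cases x <;> simp

lemma basisSign_ne_zero {ι : Type*} (x : ι ⊕ ι) : basisSign x ≠ 0 := by
  cases x <;> simp

@[simp] lemma star_basisSign {ι : Type*} (x : ι ⊕ ι) :
    (starRingEnd ℂ) (basisSign x) = basisSign x := by
  cases x <;> simp

/-- A family of vectors satisfying the relations of a symplectic basis. -/
def IsSymplecticFamily {ι : Type*} [DecidableEq ι] (Q : LinearMap.BilinForm ℂ W)
    (b : ι ⊕ ι → W) : Prop :=
  ∀ x y, Q (b x) (b y) = if y = x.swap then basisSign x else 0

variable {Q : LinearMap.BilinForm ℂ W}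

section

variable {ι : Type*} [Fintype ι] [DecidableEq ι] {b : ι ⊕ ι → W}

lemma IsSymplecticFamily.sum_left (hb : IsSymplecticFamily Q b) (c : ι ⊕ ι → ℂ) (y : ι ⊕ ι) :
    Q (b y) (∑ x, c x • b x) = basisSign y * c y.swap := by
  simp only [map_sum, map_smul, hb y, smul_eq_mul, mul_ite, mul_zero, Finset.sum_ite_eq',
    Finset.mem_univ, if_true, mul_comm]

lemma IsSymplecticFamily.linearIndependent (hb : IsSymplecticFamily Q b) :
    LinearIndependent ℂ b := by
  rw [Fintype.linearIndependent_iff]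
  intro c hc x
  have h := hb.sum_left c x.swap
  rw [hc, map_zero, Sum.swap_swap] at h
  exact (mul_eq_zero.mp h.symm).resolve_left (basisSign_ne_zero _)

end

/-- Symplectic Gram–Schmidt: make a vector outside the span orthogonal to the family, then do the
same to a vector pairing nontrivially with it, and rescale. -/
lemma IsSymplecticFamily.extend (hQ : Q.Nondegenerate) (hQalt : Q.IsAlt) {m : ℕ}
    {b : Fin m ⊕ Fin m → W} (hb : IsSymplecticFamily Q b)
    (hspan : Submodule.span ℂ (Set.range b) ≠ ⊤) :
    ∃ b' : Fin (m + 1) ⊕ Fin (m + 1) → W, IsSymplecticFamily Q b' := by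
  classical
  have proj : ∀ w : W, ∃ u ∈ Submodule.span ℂ (Set.range b), ∀ y, Q (b y) (w - u) = 0 := by
    intro w
    -- Within the family, `b x` pairs only with `b x.swap`, so the latter reads off the coefficient
    -- of `b x`.
    refine ⟨∑ x, (basisSign x.swap * Q (b x.swap) w) • b x, Submodule.sum_mem _ fun x _ =>
      Submodule.smul_mem _ _ (Submodule.subset_span ⟨x, rfl⟩), fun y => ?_⟩
    rw [map_sub, hb.sum_left, Sum.swap_swap, ← mul_assoc, basisSign_mul_self, one_mul, sub_self]
  obtain ⟨w, hw⟩ : ∃ w, w ∉ Submodule.span ℂ (Set.range b) := by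
    by_contra h
    push Not at h
    exact hspan (eq_top_iff.mpr fun x _ => h x)
  obtain ⟨u, hu, hwu⟩ := proj w
  set e := w - u with he
  have he0 : e ≠ 0 := fun h => hw (by rw [sub_eq_zero.mp h]; exact hu)
  clear_value e
  obtain ⟨y, hy⟩ : ∃ y, Q e y ≠ 0 := by
    by_contra h
    push Not at h
    exact he0 (hQ.1 e h)
  obtain ⟨t, ht, hyt⟩ := proj y
  have het : Q e t = 0 := by
    refine Submodule.span_induction (p := fun t _ => Q e t = 0) ?_ (map_zero _) ?_ ?_ ht
    · rintro _ ⟨x, rfl⟩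
      rw [← hQalt.neg_eq, hwu, neg_zero]
    · intro a c _ _ ha hc
      rw [map_add, ha, hc, add_zero]
    · intro r a _ ha
      rw [map_smul, ha, smul_zero]
  set f := (Q e y)⁻¹ • (y - t) with hf
  have hef : Q e f = 1 := by
    rw [hf, map_smul, map_sub, het, sub_zero, smul_eq_mul, inv_mul_cancel₀ hy]
  have hbf : ∀ x, Q (b x) f = 0 := fun x => by rw [hf, map_smul, hyt, smul_zero]
  have heb : ∀ x, Q e (b x) = 0 := fun x => by rw [← hQalt.neg_eq, hwu, neg_zero]
  have hfb : ∀ x, Q f (b x) = 0 := fun x => by rw [← hQalt.neg_eq, hbf, neg_zero]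
  have hfe : Q f e = -1 := by rw [← hQalt.neg_eq, hef]
  refine ⟨Sum.elim (Fin.cons e fun i => b (Sum.inl i)) (Fin.cons f fun i => b (Sum.inr i)), ?_⟩
  rintro (x | x) (y | y) <;> refine Fin.cases ?_ (fun i => ?_) x <;>
    refine Fin.cases ?_ (fun j => ?_) y <;>
    simp [hQalt.self_eq_zero, hwu, hef, hbf, heb, hfb, hfe, hb _ _, Fin.succ_ne_zero,
      (Fin.succ_ne_zero _).symm]

/-- Symplectic families are independent, hence of bounded size; one of maximal size spans, since
otherwise it could be extended. -/
lemma exists_symplecticBasis [FiniteDimensional ℂ W] (hQ : Q.Nondegenerate) (hQalt : Q.IsAlt) :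
    ∃ (m : ℕ) (b : Module.Basis (Fin m ⊕ Fin m) ℂ W), IsSymplecticFamily Q b := by
  classical
  let p : ℕ → Prop := fun m => ∃ b : Fin m ⊕ Fin m → W, IsSymplecticFamily Q b
  have hp0 : p 0 := ⟨fun x => 0, fun x => by rcases x with x | x <;> exact x.elim0⟩
  have hbound : ∀ m, p m → m ≤ Module.finrank ℂ W := by
    rintro m ⟨b, hb⟩
    have := hb.linearIndependent.fintype_card_le_finrank
    simp at this
    omega
  obtain ⟨b, hb⟩ : p (Nat.findGreatest p (Module.finrank ℂ W)) :=
    Nat.findGreatest_spec (Nat.zero_le _) hp0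
  have hspan : Submodule.span ℂ (Set.range b) = ⊤ := by
    by_contra h
    have h' : p _ := hb.extend hQ hQalt h
    have := Nat.le_findGreatest (hbound _ h') h'
    omega
  refine ⟨_, Module.Basis.mk hb.linearIndependent hspan.ge, ?_⟩
  rw [Module.Basis.coe_mk]
  exact hb

end SymplecticBasis

/-- A linear order on an arbitrary type. -/
noncomputable abbrev wellLinearOrder (B : Type*) : LinearOrder B :=
  open Classical in linearOrderOfSTO WellOrderingRel

/-! ### Creation and annihilation on the monomial basis. -/

section Monomials

variable {W : Type*} [AddCommGroup W] [Module ℂ W] {B : Type*} (b : Module.Basis B ℂ W)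

/-- The basis of the exterior algebra formed by the products of distinct elements of a basis. -/
noncomputable def wedgeBasis : Module.Basis (Finset B) ℂ (ExteriorAlgebra ℂ W) :=
  letI : LinearOrder B := wellLinearOrder B
  b.ExteriorAlgebra

lemma wedgeBasis_mem (I : Finset B) : wedgeBasis b I ∈ ⋀[ℂ]^I.card W := by
  let : LinearOrder B := wellLinearOrder B
  change b.ExteriorAlgebra I ∈ _
  rw [ExteriorAlgebra.basis_apply]
  exact (exteriorPower.ιMulti_family ℂ I.card b _).2

lemma exteriorPower_le_span (n : ℕ) :
    ⋀[ℂ]^n W ≤ Submodule.span ℂ (wedgeBasis b '' {I | I.card = n}) := by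
  let : LinearOrder B := wellLinearOrder B
  rw [← exteriorPower.ιMulti_family_span_fixedDegree_of_span ℂ b.span_eq]
  refine Submodule.span_mono ?_
  rintro _ ⟨s, rfl⟩
  exact ⟨s.1, s.2, ExteriorAlgebra.basis_apply_powersetCard b s⟩

lemma wedgeBasis_repr_eq_zero {n : ℕ} {z : ExteriorAlgebra ℂ W} (hz : z ∈ ⋀[ℂ]^n W)
    {I : Finset B} (hI : I.card ≠ n) : (wedgeBasis b).repr z I = 0 := by
  have h := exteriorPower_le_span b n hz
  rw [Module.Basis.mem_span_image] at h
  by_contra h0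
  exact hI (h (Finsupp.mem_support_iff.mpr h0))

variable [DecidableEq B]

/-- The sign depends on the auxiliary order on `B`; later arguments only need it to be ±1. -/
lemma create_wedgeBasis {x : B} {I : Finset B} (hx : x ∉ I) :
    ∃ ε : ℂ, (ε = 1 ∨ ε = -1) ∧
      create (b x) (wedgeBasis b I) = ε • wedgeBasis b (insert x I) := by
  let : LinearOrder B := wellLinearOrder B
  change ∃ ε : ℂ, (ε = 1 ∨ ε = -1) ∧
      ExteriorAlgebra.ι ℂ (b x) * b.ExteriorAlgebra I = ε • b.ExteriorAlgebra (insert x I)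
  have h1 : ExteriorAlgebra.ι ℂ (b x) = b.ExteriorAlgebra {x} := by
    rw [ExteriorAlgebra.basis_apply_ofCard b (Finset.card_singleton x),
      ExteriorAlgebra.ιMulti_family, ExteriorAlgebra.ιMulti_apply]
    simp [Set.powersetCard.ofFinEmbEquiv_symm_apply, Set.powersetCard.ofCard]
  let s : Set.powersetCard B 1 := Set.powersetCard.ofCard (Finset.card_singleton x)
  let t : Set.powersetCard B I.card := Set.powersetCard.ofCard rfl
  have hd : Disjoint s.val t.val := Finset.disjoint_singleton_left.mpr hx
  have h2 := ExteriorAlgebra.basis_mul_of_disjoint b s t hd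
  have h3 : ((Set.powersetCard.disjUnion hd : Set.powersetCard B (1 + I.card)) : Finset B) =
      insert x I := by
    ext y
    simp [s, t, Set.powersetCard.disjUnion, Set.powersetCard.ofCard]
  rw [h3] at h2
  rw [h1]
  rcases Int.units_eq_one_or (Set.powersetCard.permOfDisjoint hd).sign with h | h
  · exact ⟨1, Or.inl rfl, h2.trans (by rw [h, one_smul, one_smul])⟩
  · exact ⟨-1, Or.inr rfl, h2.trans (by rw [h]; simp)⟩

lemma annihilate_coord_create (x y : B) (z : ExteriorAlgebra ℂ W) :
    annihilate (b.coord x) (create (b y) z) =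
      (if x = y then z else 0) - create (b y) (annihilate (b.coord x) z) := by
  rw [annihilate_create]
  by_cases h : x = y
  · simp [h]
  · simp [h]

lemma annihilate_wedgeBasis_of_notMem {x : B} {I : Finset B} (hx : x ∉ I) :
    annihilate (b.coord x) (wedgeBasis b I) = 0 := by
  induction I using Finset.induction_on with
  | empty =>
    have h := wedgeBasis_mem b (∅ : Finset B)
    rw [Finset.card_empty, ExteriorAlgebra.exteriorPower, pow_zero, Submodule.mem_one] at h
    obtain ⟨r, hr⟩ := h
    rw [← hr, annihilate_algebraMap]
  | insert y I hy ih =>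
    rw [Finset.mem_insert, not_or] at hx
    obtain ⟨ε, hε, h⟩ := create_wedgeBasis b hy
    have h0 : ε • annihilate (b.coord x) (wedgeBasis b (insert y I)) = 0 := by
      rw [← map_smul, ← h, annihilate_coord_create, if_neg hx.1, ih hx.2, map_zero, sub_zero]
    refine (smul_eq_zero.mp h0).resolve_left ?_
    rcases hε with rfl | rfl <;> simp

/-- One sign serves both identities because it is its own inverse. This is what makes creation and
annihilation adjoint. -/
lemma annihilate_wedgeBasis_of_mem {x : B} {I : Finset B} (hx : x ∈ I) :
    ∃ ε : ℂ, (ε = 1 ∨ ε = -1) ∧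
      annihilate (b.coord x) (wedgeBasis b I) = ε • wedgeBasis b (I.erase x) ∧
      create (b x) (wedgeBasis b (I.erase x)) = ε • wedgeBasis b I := by
  obtain ⟨ε, hε, h⟩ := create_wedgeBasis b (Finset.notMem_erase x I)
  rw [Finset.insert_erase hx] at h
  refine ⟨ε, hε, ?_, h⟩
  have h2 : wedgeBasis b I = ε • create (b x) (wedgeBasis b (I.erase x)) := by
    rw [h, smul_smul]
    rcases hε with rfl | rfl <;> simp
  rw [h2, map_smul, annihilate_coord_create, if_pos rfl,
    annihilate_wedgeBasis_of_notMem b (Finset.notMem_erase x I), map_zero, sub_zero]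

lemma create_wedgeBasis_of_mem {x : B} {I : Finset B} (hx : x ∈ I) :
    create (b x) (wedgeBasis b I) = 0 := by
  obtain ⟨ε, hε, -, h⟩ := annihilate_wedgeBasis_of_mem b hx
  have h2 : ε • create (b x) (wedgeBasis b I) = 0 := by
    rw [← map_smul, ← h, create_create_self]
  refine (smul_eq_zero.mp h2).resolve_left ?_
  rcases hε with rfl | rfl <;> simp

lemma create_annihilate_wedgeBasis_of_notMem (v : W) {y : B} {I : Finset B} (hy : y ∉ I) :
    create v (annihilate (b.coord y) (wedgeBasis b I)) = 0 := by
  rw [annihilate_wedgeBasis_of_notMem b hy, map_zero]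

lemma create_annihilate_wedgeBasis_of_mem_of_ne {x y : B} {I : Finset B} (hx : x ∈ I)
    (hxy : x ≠ y) : create (b x) (annihilate (b.coord y) (wedgeBasis b I)) = 0 := by
  by_cases hy : y ∈ I
  · obtain ⟨ε, -, h, -⟩ := annihilate_wedgeBasis_of_mem b hy
    rw [h, map_smul, create_wedgeBasis_of_mem b (Finset.mem_erase.mpr ⟨hxy, hx⟩), smul_zero]
  · exact create_annihilate_wedgeBasis_of_notMem b _ hy

lemma create_annihilate_wedgeBasis {x y : B} {I : Finset B} (hx : x ∉ I) (hy : y ∈ I) :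
    ∃ ε : ℂ, ε ≠ 0 ∧ create (b x) (annihilate (b.coord y) (wedgeBasis b I)) =
      ε • wedgeBasis b (insert x (I.erase y)) := by
  obtain ⟨ε, hε, h, -⟩ := annihilate_wedgeBasis_of_mem b hy
  obtain ⟨δ, hδ, h'⟩ := create_wedgeBasis b (x := x) (I := I.erase y)
    (fun h => hx (Finset.mem_of_mem_erase h))
  refine ⟨ε * δ, ?_, ?_⟩
  · rcases hε with rfl | rfl <;> rcases hδ with rfl | rfl <;> simp
  · rw [h, map_smul, h', smul_smul]

lemma number_wedgeBasis (x : B) (I : Finset B) :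
    create (b x) (annihilate (b.coord x) (wedgeBasis b I)) =
      (if x ∈ I then (1 : ℂ) else 0) • wedgeBasis b I := by
  split_ifs with hx
  · obtain ⟨ε, hε, h, h'⟩ := annihilate_wedgeBasis_of_mem b hx
    rw [h, map_smul, h', smul_smul]
    rcases hε with rfl | rfl <;> simp
  · rw [create_annihilate_wedgeBasis_of_notMem b _ hx, zero_smul]

lemma sum_number_wedgeBasis [Fintype B] (I : Finset B) :
    ∑ x, create (b x) (annihilate (b.coord x) (wedgeBasis b I)) =
      (I.card : ℂ) • wedgeBasis b I := by
  classical
  simp_rw [number_wedgeBasis, ← Finset.sum_smul]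
  simp

lemma sum_number_of_mem [Fintype B] {n : ℕ} {z : ExteriorAlgebra ℂ W} (hz : z ∈ ⋀[ℂ]^n W) :
    ∑ x, create (b x) (annihilate (b.coord x) z) = (n : ℂ) • z := by
  refine Submodule.span_induction (p := fun z _ =>
    ∑ x, create (b x) (annihilate (b.coord x) z) = (n : ℂ) • z) ?_ ?_ ?_ ?_
    (exteriorPower_le_span b n hz)
  · rintro _ ⟨I, hI, rfl⟩
    rw [sum_number_wedgeBasis, show I.card = n from hI]
  · simp
  · intro u v _ _ hu hv
    simp only [map_add, Finset.sum_add_distrib, hu, hv, smul_add]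
  · intro r u _ hu
    simp only [map_smul, ← Finset.smul_sum, hu]
    rw [smul_comm]

end Monomials

/-! ### The Hermitian form with orthonormal monomials. -/

section HermitianForm

variable {W : Type*} [AddCommGroup W] [Module ℂ W] {B : Type*} [Fintype B]
  (b : Module.Basis B ℂ W)

/-- The Hermitian form on the exterior algebra for which `wedgeBasis b` is orthonormal. -/
noncomputable def herm (u : ExteriorAlgebra ℂ W) : ExteriorAlgebra ℂ W →ₗ[ℂ] ℂ :=
  ∑ I, (starRingEnd ℂ) ((wedgeBasis b).repr u I) • (wedgeBasis b).coord I

lemma herm_apply (u v : ExteriorAlgebra ℂ W) : herm b u v =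
    ∑ I, (starRingEnd ℂ) ((wedgeBasis b).repr u I) * (wedgeBasis b).repr v I := by
  simp [herm]

lemma herm_conj (u v : ExteriorAlgebra ℂ W) : (starRingEnd ℂ) (herm b u v) = herm b v u := by
  simp [herm_apply, mul_comm]

lemma herm_add_left (u u' v : ExteriorAlgebra ℂ W) :
    herm b (u + u') v = herm b u v + herm b u' v := by
  simp [herm_apply, add_mul, Finset.sum_add_distrib]

lemma herm_smul_left (c : ℂ) (u v : ExteriorAlgebra ℂ W) :
    herm b (c • u) v = (starRingEnd ℂ) c * herm b u v := by
  simp [herm_apply, Finset.mul_sum, mul_assoc]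

lemma herm_wedgeBasis_left (I : Finset B) (v : ExteriorAlgebra ℂ W) :
    herm b (wedgeBasis b I) v = (wedgeBasis b).repr v I := by
  classical
  simp [herm_apply, Finsupp.single_apply]

lemma herm_wedgeBasis [DecidableEq B] (I J : Finset B) :
    herm b (wedgeBasis b I) (wedgeBasis b J) = if I = J then 1 else 0 := by
  rw [herm_wedgeBasis_left, Module.Basis.repr_self, Finsupp.single_apply]
  exact if_congr eq_comm rfl rfl

lemma herm_create_left_wedgeBasis (x : B) (I J : Finset B) :
    herm b (create (b x) (wedgeBasis b I)) (wedgeBasis b J) =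
      herm b (wedgeBasis b I) (annihilate (b.coord x) (wedgeBasis b J)) := by
  classical
  by_cases hJ : x ∈ J
  · obtain ⟨ε, hε, h1, h2⟩ := annihilate_wedgeBasis_of_mem b hJ
    rw [h1, map_smul, herm_wedgeBasis]
    split_ifs with hIJ
    · rw [hIJ, h2, herm_smul_left, herm_wedgeBasis, if_pos rfl]
      rcases hε with rfl | rfl <;> simp
    · by_cases hI : x ∈ I
      · rw [create_wedgeBasis_of_mem b hI, ← zero_smul ℂ (0 : ExteriorAlgebra ℂ W),
          herm_smul_left]
        simp
      · obtain ⟨δ, -, h3⟩ := create_wedgeBasis b hI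
        rw [h3, herm_smul_left, herm_wedgeBasis, if_neg]
        · simp
        · rintro rfl
          exact hIJ (Finset.erase_insert hI).symm
  · rw [annihilate_wedgeBasis_of_notMem b hJ, map_zero]
    by_cases hI : x ∈ I
    · rw [create_wedgeBasis_of_mem b hI, ← zero_smul ℂ (0 : ExteriorAlgebra ℂ W),
        herm_smul_left]
      simp
    · obtain ⟨δ, -, h3⟩ := create_wedgeBasis b hI
      rw [h3, herm_smul_left, herm_wedgeBasis, if_neg, mul_zero]
      rintro rfl
      exact hJ (Finset.mem_insert_self x I)

/-- Exterior multiplication and contraction are adjoint to each other. -/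
lemma herm_create_left (x : B) (u v : ExteriorAlgebra ℂ W) :
    herm b (create (b x) u) v = herm b u (annihilate (b.coord x) v) := by
  refine Submodule.span_induction (p := fun u _ => herm b (create (b x) u) v =
    herm b u (annihilate (b.coord x) v)) ?_ ?_ ?_ ?_ ((wedgeBasis b).mem_span u)
  · rintro _ ⟨I, rfl⟩
    suffices h : herm b (create (b x) (wedgeBasis b I)) =
        herm b (wedgeBasis b I) ∘ₗ annihilate (b.coord x) from LinearMap.congr_fun h v
    exact (wedgeBasis b).ext fun J => herm_create_left_wedgeBasis b x I J
  · simp [herm_apply]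
  · intro u u' _ _ hu hu'
    rw [map_add, herm_add_left, herm_add_left, hu, hu']
  · intro r u _ hu
    rw [map_smul, herm_smul_left, herm_smul_left, hu]

lemma herm_annihilate_left (x : B) (u v : ExteriorAlgebra ℂ W) :
    herm b (annihilate (b.coord x) u) v = herm b u (create (b x) v) := by
  rw [← herm_conj, ← herm_create_left, herm_conj]

end HermitianForm

/-! ### Root operators of the symplectic Lie algebra and their adjoints. -/

section SymplecticOperators

variable {W : Type*} [AddCommGroup W] [Module ℂ W] {Q : LinearMap.BilinForm ℂ W}
  {ι : Type*} (b : Module.Basis (ι ⊕ ι) ℂ W)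

/-- The operator on the exterior algebra that extends `symDerivation` on two vectors of a
symplectic basis. -/
noncomputable def rootOperator (x y : ι ⊕ ι) : Module.End ℂ (ExteriorAlgebra ℂ W) :=
  basisSign y • (create (b x) * annihilate (b.coord y.swap)) +
    basisSign x • (create (b y) * annihilate (b.coord x.swap))

lemma rootOperator_apply (x y : ι ⊕ ι) (z : ExteriorAlgebra ℂ W) : rootOperator b x y z =
    basisSign y • create (b x) (annihilate (b.coord y.swap) z) +
      basisSign x • create (b y) (annihilate (b.coord x.swap) z) := rfl

variable {b}

section

variable [DecidableEq ι]

lemma IsSymplecticFamily.form_eq (hb : IsSymplecticFamily Q b) (x : ι ⊕ ι) :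
    Q (b x) = basisSign x • b.coord x.swap := by
  refine b.ext fun y => ?_
  rw [hb]
  by_cases h : y = x.swap
  · simp [h]
  · simp [h]

lemma IsSymplecticFamily.toAlgebra_symDerivation (hb : IsSymplecticFamily Q b) {n : ℕ}
    {V : Type*} [AddCommGroup V] [Module ℂ V] (e : V ≃ₗ[ℂ] ⋀[ℂ]^n W) (x y : ι ⊕ ι) (z : V) :
    toAlgebra e (symDerivation Q e (b x) (b y) z) = rootOperator b x y (toAlgebra e z) := by
  rw [SymplecticExterior.toAlgebra_symDerivation, hb.form_eq, hb.form_eq, rootOperator_apply]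
  simp only [map_smul, LinearMap.smul_apply]

end

/-- Taking adjoints exchanges creation and annihilation, hence, up to sign, each basis vector with
its symplectic partner. So 𝔤 is closed under adjoints. -/
lemma herm_rootOperator_left [Fintype ι] (x y : ι ⊕ ι) (u v : ExteriorAlgebra ℂ W) :
    herm b (rootOperator b x y u) v =
      herm b u (-(basisSign x * basisSign y) • rootOperator b x.swap y.swap v) := by
  simp only [rootOperator_apply, herm_add_left, herm_smul_left, herm_create_left,
    herm_annihilate_left, Sum.swap_swap, basisSign_swap, map_smul, map_add, smul_add, smul_smul,
    star_basisSign, smul_eq_mul]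
  rcases x with x | x <;> rcases y with y | y <;>
    simp only [basisSign_inl, basisSign_inr, Sum.swap_inl, Sum.swap_inr] <;> ring

end SymplecticOperators

/-! ### Abstract Casimir elements and square-zero normalizing elements. -/

section Casimir

/-- The Casimir element of a space `𝔤` with a reproducing pair of families for a trace is fixed
by every automorphism that preserves the trace and `𝔤`. -/
lemma casimir_fixed {A : Type*} [Ring A] [Algebra ℂ A] (τ : A →ₗ[ℂ] ℂ)
    {I : Type*} [Fintype I] {Z Z' : I → A} {𝔤 : Submodule ℂ A}
    (hZ : ∀ i, Z i ∈ 𝔤) (hZ' : ∀ i, Z' i ∈ 𝔤) {c : ℂ} (hc : c ≠ 0)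
    (h1 : ∀ Y ∈ 𝔤, ∑ i, τ (Z' i * Y) • Z i = c • Y)
    (h2 : ∀ Y ∈ 𝔤, ∑ i, τ (Y * Z i) • Z' i = c • Y)
    (φ : A ≃ₐ[ℂ] A) (hτ : ∀ a, τ (φ a) = τ a) (hφ : ∀ Y ∈ 𝔤, φ Y ∈ 𝔤)
    (hφ' : ∀ Y ∈ 𝔤, φ.symm Y ∈ 𝔤) :
    φ (∑ i, Z i * Z' i) = ∑ i, Z i * Z' i := by
  -- The coefficients of φ(Z i) in the family `Z` are those of φ⁻¹(Z' j) in the family `Z'`; the two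
  -- expansions can therefore be traded.
  have key : ∀ i j, τ (Z' j * φ (Z i)) = τ (φ.symm (Z' j) * Z i) := by
    intro i j
    rw [← hτ (φ.symm (Z' j) * Z i), map_mul φ, AlgEquiv.apply_symm_apply]
  have h : c • φ (∑ i, Z i * Z' i) = c • ∑ i, Z i * Z' i := by
    calc c • φ (∑ i, Z i * Z' i) = ∑ i, (c • φ (Z i)) * φ (Z' i) := by
          simp only [map_sum, map_mul, Finset.smul_sum, smul_mul_assoc]
      _ = ∑ i, (∑ j, τ (φ.symm (Z' j) * Z i) • Z j) * φ (Z' i) := by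
          refine Finset.sum_congr rfl fun i _ => ?_
          rw [← h1 _ (hφ _ (hZ i))]
          simp only [key]
      _ = ∑ j, Z j * φ (∑ i, τ (φ.symm (Z' j) * Z i) • Z' i) := by
          simp only [Finset.sum_mul, map_sum, map_smul, Finset.mul_sum, smul_mul_assoc,
            mul_smul_comm]
          exact Finset.sum_comm
      _ = c • ∑ j, Z j * Z' j := by
          rw [Finset.smul_sum]
          refine Finset.sum_congr rfl fun j _ => ?_
          rw [h2 _ (hφ' _ (hZ' j)), map_smul, AlgEquiv.apply_symm_apply, mul_smul_comm]
  exact smul_right_injective A hc h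

variable {V : Type*} [AddCommGroup V] [Module ℂ V]

lemma trace_mul_eq_zero_of_sq_eq_zero {X Y : Module.End ℂ V} (hX : X * X = 0)
    (h : X * Y = Y * X) : LinearMap.trace ℂ V (X * Y) = 0 := by
  have hX' : IsNilpotent X := ⟨2, by rw [pow_two, hX]⟩
  have hXY : IsNilpotent (X * Y) := Commute.isNilpotent_mul_right h hX'
  exact (LinearMap.isNilpotent_trace_of_isNilpotent hXY).eq_zero

/-- A square-zero endomorphism normalizing a suitable Lie algebra `𝔤` of endomorphisms lies
in `𝔤`. -/
lemma mem_of_sq_eq_zero_of_normalizes {I : Type*} [Fintype I] {Z Z' : I → Module.End ℂ V}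
    {𝔤 : Submodule ℂ (Module.End ℂ V)} (hZ : ∀ i, Z i ∈ 𝔤) {c : ℂ} (hc : c ≠ 0)
    (h2 : ∀ Y ∈ 𝔤, ∑ i, LinearMap.trace ℂ V (Y * Z i) • Z' i = c • Y)
    {S : Set (Module.End ℂ V)} (hS : 𝔤 = Submodule.span ℂ S) (hsq : ∀ s ∈ S, s * s = 0)
    (hbr : ∀ Y ∈ 𝔤, ∀ Y' ∈ 𝔤, Y * Y' - Y' * Y ∈ 𝔤)
    (dag : Module.End ℂ V → Module.End ℂ V) (hdag : ∀ T, dag (dag T) = T)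
    (hmul : ∀ T T', dag (T * T') = dag T' * dag T)
    (hpos : ∀ T, LinearMap.trace ℂ V (T * dag T) = 0 → T = 0)
    (hdag𝔤 : ∀ Y ∈ 𝔤, dag Y ∈ 𝔤)
    (hcomm : ∀ T T', (∀ Y ∈ 𝔤, T * Y = Y * T) → (∀ Y ∈ 𝔤, T' * Y = Y * T') → T * T' = T' * T)
    {X : Module.End ℂ V} (hX : X * X = 0) (hXbr : ∀ Y ∈ 𝔤, X * Y - Y * X ∈ 𝔤) : X ∈ 𝔤 := by
  set τ := LinearMap.trace ℂ V with hτ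
  -- P is the part of cX in 𝔤 seen by the trace form; the remainder R is trace-orthogonal to 𝔤, and
  -- the aim is R = 0.
  set P := ∑ i, τ (Z' i * X) • Z i with hP
  have hP𝔤 : P ∈ 𝔤 := Submodule.sum_mem _ fun i _ => Submodule.smul_mem _ _ (hZ i)
  set R := c • X - P with hR
  clear_value R
  have hRorth : ∀ Y ∈ 𝔤, τ (R * Y) = 0 := by
    intro Y hY
    have e1 : τ (P * Y) = ∑ i, τ (Y * Z i) * τ (Z' i * X) := by
      rw [hP, Finset.sum_mul, map_sum]
      refine Finset.sum_congr rfl fun i _ => ?_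
      rw [smul_mul_assoc, map_smul, smul_eq_mul, LinearMap.trace_mul_comm ℂ (Z i), mul_comm]
    have e2 : τ ((c • Y) * X) = ∑ i, τ (Y * Z i) * τ (Z' i * X) := by
      rw [← h2 Y hY, Finset.sum_mul, map_sum]
      simp only [smul_mul_assoc, map_smul, smul_eq_mul]
    rw [hR, sub_mul, map_sub, e1, ← e2, smul_mul_assoc, smul_mul_assoc, map_smul, map_smul,
      hτ, LinearMap.trace_mul_comm ℂ X, sub_self]
  have hRbr : ∀ Y ∈ 𝔤, R * Y - Y * R ∈ 𝔤 := by
    intro Y hY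
    have : R * Y - Y * R = c • (X * Y - Y * X) - (P * Y - Y * P) := by
      rw [hR]; simp only [sub_mul, mul_sub, smul_mul_assoc, mul_smul_comm]; module
    rw [this]
    exact sub_mem (Submodule.smul_mem _ _ (hXbr Y hY)) (hbr P hP𝔤 Y hY)
  have hZ'𝔤 : ∀ Y ∈ 𝔤, (∀ Y' ∈ 𝔤, τ (Y' * Y) = 0) → Y = 0 := by
    intro Y hY h
    have h3 : c • Y = 0 := by
      rw [← h2 Y hY]
      refine Finset.sum_eq_zero fun i _ => ?_
      rw [LinearMap.trace_mul_comm ℂ Y, h _ (hZ i), zero_smul]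
    exact (smul_eq_zero.mp h3).resolve_left hc
  -- [R, Y] lies in 𝔤 and is trace-orthogonal to it, since τ(Y'[R, Y]) = τ(R[Y, Y']) = 0; the trace
  -- form is non-degenerate on 𝔤.
  have hRcomm : ∀ Y ∈ 𝔤, R * Y = Y * R := by
    intro Y hY
    rw [← sub_eq_zero]
    refine hZ'𝔤 _ (hRbr Y hY) fun Y' hY' => ?_
    have e1 : τ (Y' * (R * Y - Y * R)) = τ (R * (Y * Y' - Y' * Y)) := by
      rw [mul_sub, mul_sub, map_sub, map_sub, ← mul_assoc Y' Y R, hτ,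
        LinearMap.trace_mul_comm ℂ (Y' * Y) R, LinearMap.trace_mul_comm ℂ Y' (R * Y), mul_assoc]
    rw [e1, hRorth _ (hbr Y hY Y' hY')]
  have hDcomm : ∀ Y ∈ 𝔤, dag R * Y = Y * dag R := by
    intro Y hY
    have h3 := congrArg dag (hRcomm (dag Y) (hdag𝔤 Y hY))
    rw [hmul, hmul, hdag] at h3
    exact h3.symm
  -- In cX = R + P, `dag R` commutes with R as the commutant is commutative, and with P as P ∈ 𝔤.
  have hXD : X * dag R = dag R * X := by
    have h3 : c • (X * dag R) = c • (dag R * X) := by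
      have hcX : c • X = R + P := by rw [hR]; abel
      rw [← smul_mul_assoc, ← mul_smul_comm, hcX, add_mul, mul_add, hcomm R (dag R) hRcomm hDcomm,
        hDcomm P hP𝔤]
    exact smul_right_injective _ hc h3
  have hPD : ∀ Y ∈ 𝔤, τ (Y * dag R) = 0 := by
    intro Y hY
    rw [hS] at hY
    refine Submodule.span_induction (p := fun Y _ => τ (Y * dag R) = 0) ?_ ?_ ?_ ?_ hY
    · intro s hs
      exact trace_mul_eq_zero_of_sq_eq_zero (hsq s hs)
        (hDcomm s (hS ▸ Submodule.subset_span hs)).symm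
    · rw [zero_mul, map_zero]
    · intro a d _ _ ha hd
      rw [add_mul, map_add, ha, hd, add_zero]
    · intro r a _ ha
      rw [smul_mul_assoc, map_smul, ha, smul_zero]
  -- τ(R · dag R) = c τ(X · dag R) − τ(P · dag R). Both traces vanish: X and the generators of 𝔤 are
  -- square-zero and commute with `dag R`.
  have hR0 : R = 0 := by
    apply hpos
    nth_rewrite 1 [hR]
    rw [sub_mul, map_sub, hPD P hP𝔤, smul_mul_assoc, map_smul, hτ,
      trace_mul_eq_zero_of_sq_eq_zero hX hXD, smul_zero, sub_zero]
  have hXP : X = c⁻¹ • P := by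
    rw [← sub_eq_zero.mp (hR.symm.trans hR0), smul_smul, inv_mul_cancel₀ hc, one_smul]
  rw [hXP]
  exact Submodule.smul_mem _ _ hP𝔤

end Casimir

/-! ### The trace form on the symplectic Lie algebra. -/

section TraceForm

variable {W : Type*} [AddCommGroup W] [Module ℂ W] {Q : LinearMap.BilinForm ℂ W} {n : ℕ}
  {V : Type*} [AddCommGroup V] [Module ℂ V] (e : V ≃ₗ[ℂ] ⋀[ℂ]^n W)

lemma conj_powerAction {f : W ≃ₗ[ℂ] W} (hf : f ∈ symplecticSubgroup Q) (v : W) :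
    (powerAction e f).conjAlgEquiv ℂ (transvectionDerivation Q e v) =
      transvectionDerivation Q e (f v) := by
  ext z
  rw [LinearEquiv.conjAlgEquiv_apply, LinearMap.comp_apply, LinearMap.comp_apply,
    LinearEquiv.coe_coe, powerAction_transvectionDerivation e hf]
  simp

lemma trace_conjAlgEquiv (g : V ≃ₗ[ℂ] V) (T : Module.End ℂ V) :
    LinearMap.trace ℂ V (g.conjAlgEquiv ℂ T) = LinearMap.trace ℂ V T :=
  LinearMap.trace_conj' T g

lemma trace_transvectionDerivation_map {f : W ≃ₗ[ℂ] W} (hf : f ∈ symplecticSubgroup Q)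
    (v w : W) :
    LinearMap.trace ℂ V (transvectionDerivation Q e (f v) * transvectionDerivation Q e (f w)) =
      LinearMap.trace ℂ V (transvectionDerivation Q e v * transvectionDerivation Q e w) := by
  rw [← conj_powerAction e hf, ← conj_powerAction e hf, ← map_mul, trace_conjAlgEquiv]

/-- A transvection along u fixes v and moves w to w + cu, so tr(D_v D_{w+cu}) does not depend on c.
The values c = ±1 isolate its linear and quadratic coefficients. -/
lemma trace_of_orthogonal_aux (hQalt : Q.IsAlt) {u v w : W} (huv : Q u v = 0)
    (huw : Q u w ≠ 0) :
    LinearMap.trace ℂ V (transvectionDerivation Q e v * symDerivation Q e w u) = 0 ∧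
    LinearMap.trace ℂ V (transvectionDerivation Q e v * transvectionDerivation Q e u) = 0 := by
  have key : ∀ c : ℂ,
      c * LinearMap.trace ℂ V (transvectionDerivation Q e v * symDerivation Q e w u) +
      c ^ 2 * LinearMap.trace ℂ V
        (transvectionDerivation Q e v * transvectionDerivation Q e u) = 0 := by
    intro c
    have h := trace_transvectionDerivation_map e
      (transvection_mem hQalt u (c * (Q u w)⁻¹)) v w
    rw [transvection_apply, transvection_apply, huv, mul_zero, zero_smul, add_zero, mul_assoc,
      inv_mul_cancel₀ huw, mul_one, transvectionDerivation_add_smul] at h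
    simp only [mul_add, mul_smul_comm, map_add, map_smul, smul_eq_mul] at h
    linear_combination h
  have h1 := key 1
  have h2 := key (-1)
  constructor
  · linear_combination (h1 - h2) / 2
  · linear_combination (h1 + h2) / 2

lemma exists_form_ne_zero (hQ : Q.Nondegenerate) {v : W} (hv : v ≠ 0) : ∃ w, Q v w ≠ 0 := by
  by_contra h
  push Not at h
  exact hv (hQ.1 v h)

lemma trace_of_orthogonal (hQ : Q.Nondegenerate) (hQalt : Q.IsAlt) {u v : W} (huv : Q u v = 0)
    (w : W) :
    LinearMap.trace ℂ V (transvectionDerivation Q e v * symDerivation Q e w u) = 0 ∧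
    LinearMap.trace ℂ V (transvectionDerivation Q e v * transvectionDerivation Q e u) = 0 := by
  by_cases hu : u = 0
  · subst hu
    simp [transvectionDerivation]
  obtain ⟨w₀, hw₀⟩ := exists_form_ne_zero hQ hu
  by_cases hw : Q u w = 0
  · have h1 := trace_of_orthogonal_aux e hQalt huv hw₀
    have h2 := trace_of_orthogonal_aux e hQalt (w := w + w₀) huv (by rwa [map_add, hw, zero_add])
    refine ⟨?_, h1.2⟩
    have h3 := h2.1
    rw [map_add, LinearMap.add_apply, mul_add, map_add, h1.1, add_zero] at h3
    exact h3
  · exact trace_of_orthogonal_aux e hQalt huv hw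

/-- Fix y with Q(v, y) ≠ 0. Then w is a multiple of y plus a vector orthogonal to v, and the latter
contributes nothing to the trace. -/
lemma exists_trace_eq_mul_sq (hQ : Q.Nondegenerate) (hQalt : Q.IsAlt) (v : W) :
    ∃ κ : ℂ, ∀ w, LinearMap.trace ℂ V
      (transvectionDerivation Q e v * transvectionDerivation Q e w) = κ * Q v w ^ 2 := by
  by_cases hv : v = 0
  · subst hv
    exact ⟨0, by simp [transvectionDerivation]⟩
  obtain ⟨y, hy⟩ := exists_form_ne_zero hQ hv
  refine ⟨LinearMap.trace ℂ V (transvectionDerivation Q e v * transvectionDerivation Q e y) /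
    Q v y ^ 2, fun w => ?_⟩
  set d := Q v w / Q v y with hd
  have hu : Q (w - d • y) v = 0 := by
    rw [← hQalt.neg_eq, map_sub, map_smul, smul_eq_mul, hd, div_mul_cancel₀ _ hy, sub_self,
      neg_zero]
  have hw : transvectionDerivation Q e w = transvectionDerivation Q e ((w - d • y) + d • y) := by
    rw [sub_add_cancel]
  have h := trace_of_orthogonal e hQ hQalt hu y
  rw [hw, transvectionDerivation_add_smul]
  simp only [mul_add, mul_smul_comm, map_add, map_smul, smul_eq_mul]
  rw [h.2, symDerivation_comm, h.1, hd]
  field_simp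
  simp

/-- The trace form of `⋀ⁿ W` on the symplectic Lie algebra is a multiple of the standard one. -/
lemma exists_trace_eq (hQ : Q.Nondegenerate) (hQalt : Q.IsAlt) :
    ∃ κ : ℂ, ∀ v w, LinearMap.trace ℂ V
      (transvectionDerivation Q e v * transvectionDerivation Q e w) = κ * Q v w ^ 2 := by
  choose κ hκ using exists_trace_eq_mul_sq (V := V) e hQ hQalt
  have hsymm : ∀ v w, Q v w ≠ 0 → κ v = κ w := by
    intro v w h
    have h1 := hκ v w
    rw [LinearMap.trace_mul_comm, hκ w v, ← hQalt.neg_eq v w, neg_sq] at h1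
    exact (mul_right_cancel₀ (pow_ne_zero 2 h) h1).symm
  by_cases h0 : ∃ v₀ : W, v₀ ≠ 0
  · obtain ⟨v₀, hv₀⟩ := h0
    refine ⟨κ v₀, fun v w => ?_⟩
    by_cases hv : v = 0
    · subst hv
      simp [transvectionDerivation]
    suffices h : κ v = κ v₀ by rw [hκ, h]
    obtain ⟨y, hy⟩ := exists_form_ne_zero hQ hv
    obtain ⟨y₀, hy₀⟩ := exists_form_ne_zero hQ hv₀
    -- A vector space is not the union of two hyperplanes; such a u links the constants of v and v₀
    -- by symmetry of the trace.
    obtain ⟨u, hu, hu₀⟩ : ∃ u, Q v u ≠ 0 ∧ Q v₀ u ≠ 0 := by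
      by_cases h1 : Q v y₀ = 0
      · by_cases h2 : Q v₀ y = 0
        · exact ⟨y + y₀, by rwa [map_add, h1, add_zero], by rwa [map_add, h2, zero_add]⟩
        · exact ⟨y, hy, h2⟩
      · exact ⟨y₀, h1, hy₀⟩
    rw [hsymm v u hu, hsymm v₀ u hu₀]
  · push Not at h0
    exact ⟨0, fun v w => by rw [h0 v]; simp [transvectionDerivation]⟩

end TraceForm

/-! ### The Casimir operator and conjugations preserving the Lie algebra. -/

section CasimirOperator

variable {W : Type*} [AddCommGroup W] [Module ℂ W] (Q : LinearMap.BilinForm ℂ W) {n : ℕ}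
  {V : Type*} [AddCommGroup V] [Module ℂ V] (e : V ≃ₗ[ℂ] ⋀[ℂ]^n W)
  {ι : Type*} [Fintype ι] (b : Module.Basis (ι ⊕ ι) ℂ W)

/-- The Casimir operator of the symplectic Lie algebra on `⋀ⁿ W`, up to a scalar. -/
noncomputable def casimir : Module.End ℂ V :=
  ∑ p : (ι ⊕ ι) × (ι ⊕ ι), symDerivation Q e (b p.1) (b p.2) *
    ((basisSign p.1 * basisSign p.2) • symDerivation Q e (b p.1.swap) (b p.2.swap))

variable {Q} {b}

lemma trace_symDerivation_mul {κ : ℂ} (hκ : ∀ v w, LinearMap.trace ℂ V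
      (transvectionDerivation Q e v * transvectionDerivation Q e w) = κ * Q v w ^ 2) (u u' v : W) :
    LinearMap.trace ℂ V (symDerivation Q e u u' * transvectionDerivation Q e v) =
      2 * κ * (Q u v * Q u' v) := by
  rw [symDerivation_eq_sub, sub_mul, sub_mul, map_sub, map_sub, hκ, hκ, hκ, map_add,
    LinearMap.add_apply]
  ring

lemma sum_coord_symDerivation (v : W) :
    ∑ p : (ι ⊕ ι) × (ι ⊕ ι), (b.coord p.1 v * b.coord p.2 v) •
      symDerivation Q e (b p.1) (b p.2) = (2 : ℂ) • transvectionDerivation Q e v := by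
  rw [← symDerivation_self]
  conv_rhs => rw [← b.sum_repr v]
  rw [Fintype.sum_prod_type]
  simp only [map_sum, map_smul, LinearMap.sum_apply, LinearMap.smul_apply, Module.Basis.coord_apply,
    Finset.smul_sum, smul_smul]
  rw [Finset.sum_comm]
  refine Finset.sum_congr rfl fun x _ => Finset.sum_congr rfl fun y _ => ?_
  rw [mul_comm]

variable [DecidableEq ι]

/-- The trace of the p-th dual element against D_v is 2κ times a product of two coordinates of v;
summing over p rebuilds 2κ · 2D_v. -/
lemma reproducing_left (hb : IsSymplecticFamily Q b) {κ : ℂ} (hκ : ∀ v w, LinearMap.trace ℂ V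
      (transvectionDerivation Q e v * transvectionDerivation Q e w) = κ * Q v w ^ 2)
    (Y : Module.End ℂ V) (hY : Y ∈ symplecticDerivations Q e) :
    ∑ p : (ι ⊕ ι) × (ι ⊕ ι), LinearMap.trace ℂ V
      (((basisSign p.1 * basisSign p.2) • symDerivation Q e (b p.1.swap) (b p.2.swap)) * Y) •
      symDerivation Q e (b p.1) (b p.2) = (4 * κ) • Y := by
  refine Submodule.span_induction (p := fun Y _ => ∑ p : (ι ⊕ ι) × (ι ⊕ ι), LinearMap.trace ℂ V
      (((basisSign p.1 * basisSign p.2) • symDerivation Q e (b p.1.swap) (b p.2.swap)) * Y) •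
      symDerivation Q e (b p.1) (b p.2) = (4 * κ) • Y) ?_ ?_ ?_ ?_ hY
  · rintro _ ⟨v, rfl⟩
    have h : ∀ p : (ι ⊕ ι) × (ι ⊕ ι), LinearMap.trace ℂ V
        (((basisSign p.1 * basisSign p.2) • symDerivation Q e (b p.1.swap) (b p.2.swap)) *
          transvectionDerivation Q e v) = (2 * κ) * (b.coord p.1 v * b.coord p.2 v) := by
      intro p
      rw [smul_mul_assoc, map_smul, trace_symDerivation_mul e hκ, hb.form_eq, hb.form_eq,
        Sum.swap_swap, Sum.swap_swap, basisSign_swap, basisSign_swap, smul_eq_mul,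
        LinearMap.smul_apply, LinearMap.smul_apply, smul_eq_mul, smul_eq_mul]
      linear_combination (2 * κ * (b.coord p.1 v * b.coord p.2 v) *
        (basisSign p.2 * basisSign p.2)) * basisSign_mul_self p.1 +
        (2 * κ * (b.coord p.1 v * b.coord p.2 v)) * basisSign_mul_self p.2
    simp only [h, mul_smul (2 * κ)]
    rw [← Finset.smul_sum, sum_coord_symDerivation, smul_smul]
    congr 1
    ring
  · simp
  · intro S T _ _ hS hT
    simp only [mul_add, map_add, add_smul, Finset.sum_add_distrib, smul_add]
    rw [hS, hT]
  · intro r S _ hS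
    rw [smul_comm, ← hS, Finset.smul_sum]
    refine Finset.sum_congr rfl fun p _ => ?_
    rw [mul_smul_comm, map_smul, smul_assoc]

/-- Swapping both indices interchanges the two families up to a common sign, so this is
`reproducing_left` reindexed. -/
lemma reproducing_right (hb : IsSymplecticFamily Q b) {κ : ℂ} (hκ : ∀ v w, LinearMap.trace ℂ V
      (transvectionDerivation Q e v * transvectionDerivation Q e w) = κ * Q v w ^ 2)
    (Y : Module.End ℂ V) (hY : Y ∈ symplecticDerivations Q e) :
    ∑ p : (ι ⊕ ι) × (ι ⊕ ι), LinearMap.trace ℂ V (Y * symDerivation Q e (b p.1) (b p.2)) •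
      ((basisSign p.1 * basisSign p.2) • symDerivation Q e (b p.1.swap) (b p.2.swap)) =
      (4 * κ) • Y := by
  rw [← reproducing_left e hb hκ Y hY]
  let σ : (ι ⊕ ι) × (ι ⊕ ι) ≃ (ι ⊕ ι) × (ι ⊕ ι) :=
    Equiv.prodCongr (Equiv.sumComm ι ι) (Equiv.sumComm ι ι)
  rw [← Equiv.sum_comp σ]
  refine Finset.sum_congr rfl fun p _ => ?_
  change LinearMap.trace ℂ V (Y * symDerivation Q e (b p.1.swap) (b p.2.swap)) •
      ((basisSign p.1.swap * basisSign p.2.swap) •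
        symDerivation Q e (b p.1.swap.swap) (b p.2.swap.swap)) = _
  rw [Sum.swap_swap, Sum.swap_swap, basisSign_swap, basisSign_swap, neg_mul_neg, smul_mul_assoc,
    map_smul, LinearMap.trace_mul_comm, smul_smul, smul_eq_mul, mul_comm]

lemma trace_mul_eq_zero {κ : ℂ} (hκ : ∀ v w, LinearMap.trace ℂ V
      (transvectionDerivation Q e v * transvectionDerivation Q e w) = κ * Q v w ^ 2)
    (h0 : κ = 0) {Y Y' : Module.End ℂ V} (hY : Y ∈ symplecticDerivations Q e)
    (hY' : Y' ∈ symplecticDerivations Q e) : LinearMap.trace ℂ V (Y * Y') = 0 := by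
  refine Submodule.span_induction (p := fun Y _ => LinearMap.trace ℂ V (Y * Y') = 0)
    ?_ ?_ ?_ ?_ hY
  · rintro _ ⟨v, rfl⟩
    refine Submodule.span_induction (p := fun Y' _ =>
      LinearMap.trace ℂ V (transvectionDerivation Q e v * Y') = 0) ?_ ?_ ?_ ?_ hY'
    · rintro _ ⟨w, rfl⟩
      rw [hκ, h0, zero_mul]
    · simp
    · intro S T _ _ hS hT
      rw [mul_add, map_add, hS, hT, add_zero]
    · intro r S _ hS
      rw [mul_smul_comm, map_smul, hS, smul_zero]
  · simp
  · intro S T _ _ hS hT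
    rw [add_mul, map_add, hS, hT, add_zero]
  · intro r S _ hS
    rw [smul_mul_assoc, map_smul, hS, smul_zero]

/-- The even part Y − XYX cancels in the difference of the two products, leaving 2[X, Y]. This
passes from group to Lie algebra without differentiation. -/
lemma conj_one_add_mem {𝔤 : Submodule ℂ (Module.End ℂ V)} {X Y : Module.End ℂ V}
    (h1 : (1 + X) * Y * (1 - X) ∈ 𝔤) (h2 : (1 - X) * Y * (1 + X) ∈ 𝔤) :
    X * Y - Y * X ∈ 𝔤 := by
  have h : X * Y - Y * X =
      (2⁻¹ : ℂ) • ((1 + X) * Y * (1 - X) - (1 - X) * Y * (1 + X)) := by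
    have : (1 + X) * Y * (1 - X) - (1 - X) * Y * (1 + X) = (2 : ℂ) • (X * Y - Y * X) := by
      rw [two_smul]; noncomm_ring
    rw [this, smul_smul]
    norm_num
  rw [h]
  exact Submodule.smul_mem _ _ (sub_mem h1 h2)

lemma conj_powerAction_mem {f : W ≃ₗ[ℂ] W} (hf : f ∈ symplecticSubgroup Q)
    {Y : Module.End ℂ V} (hY : Y ∈ symplecticDerivations Q e) :
    (powerAction e f).conjAlgEquiv ℂ Y ∈ symplecticDerivations Q e := by
  refine Submodule.span_induction
    (p := fun Y _ => (powerAction e f).conjAlgEquiv ℂ Y ∈ symplecticDerivations Q e)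
    ?_ ?_ ?_ ?_ hY
  · rintro _ ⟨v, rfl⟩
    rw [conj_powerAction e hf]
    exact transvectionDerivation_mem Q e _
  · rw [map_zero]; exact zero_mem _
  · intro S T _ _ hS hT
    rw [map_add]; exact add_mem hS hT
  · intro r S _ hS
    rw [map_smul]; exact Submodule.smul_mem _ _ hS

lemma powerAction_symm (f : W ≃ₗ[ℂ] W) : (powerAction e f).symm = powerAction e f⁻¹ := by
  ext z
  rw [LinearEquiv.symm_apply_eq]
  simp [powerAction]

/-- If `1 + X` with `X² = 0` is the action of a symplectic automorphism, then `X` normalizes the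
symplectic Lie algebra. -/
lemma bracket_mem_of_powerAction {f : W ≃ₗ[ℂ] W} (hf : f ∈ symplecticSubgroup Q)
    {X : Module.End ℂ V} (hX : X * X = 0) (hfX : ∀ z, powerAction e f z = z + X z)
    {Y : Module.End ℂ V} (hY : Y ∈ symplecticDerivations Q e) :
    X * Y - Y * X ∈ symplecticDerivations Q e := by
  have hX' : ∀ z, X (X z) = 0 := fun z => LinearMap.congr_fun hX z
  have hsymm : ∀ z, (powerAction e f).symm z = z - X z := by
    intro z
    rw [LinearEquiv.symm_apply_eq, hfX, map_sub, hX', sub_zero, sub_add_cancel]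
  refine conj_one_add_mem ?_ ?_
  · convert conj_powerAction_mem e hf hY using 1
    ext z
    rw [LinearEquiv.conjAlgEquiv_apply, LinearMap.comp_apply, LinearMap.comp_apply,
      LinearEquiv.coe_coe, LinearEquiv.coe_coe, hfX, hsymm]
    rfl
  · convert conj_powerAction_mem e (inv_mem hf) hY using 1
    ext z
    rw [← powerAction_symm, LinearEquiv.conjAlgEquiv_apply, LinearMap.comp_apply,
      LinearMap.comp_apply, LinearEquiv.coe_coe, LinearEquiv.coe_coe, hsymm,
      LinearEquiv.symm_symm, hfX]
    rfl

/-- For Y = D_v, 1 + Y is the action of a transvection, whose conjugation preserves 𝔤. -/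
lemma bracket_mem (hQalt : Q.IsAlt) {Y Y' : Module.End ℂ V}
    (hY : Y ∈ symplecticDerivations Q e) (hY' : Y' ∈ symplecticDerivations Q e) :
    Y * Y' - Y' * Y ∈ symplecticDerivations Q e := by
  refine Submodule.span_induction
    (p := fun Y _ => Y * Y' - Y' * Y ∈ symplecticDerivations Q e) ?_ ?_ ?_ ?_ hY
  · rintro _ ⟨v, rfl⟩
    exact bracket_mem_of_powerAction e (transvection_mem hQalt v 1)
      (transvectionDerivation_mul_self e hQalt v) (powerAction_transvection e hQalt v) hY'
  · simp
  · intro S T _ _ hS hT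
    convert add_mem hS hT using 1
    noncomm_ring
  · intro r S _ hS
    convert Submodule.smul_mem _ r hS using 1
    rw [smul_sub, smul_mul_assoc, mul_smul_comm]

/-- An automorphism of `V` that normalizes the symplectic Lie algebra commutes with the Casimir
operator. -/
lemma casimir_conj (hb : IsSymplecticFamily Q b) {κ : ℂ} (hκ : ∀ v w, LinearMap.trace ℂ V
      (transvectionDerivation Q e v * transvectionDerivation Q e w) = κ * Q v w ^ 2)
    (h0 : κ ≠ 0) (g : V ≃ₗ[ℂ] V)
    (hg : ∀ Y ∈ symplecticDerivations Q e, g.conjAlgEquiv ℂ Y ∈ symplecticDerivations Q e)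
    (hg' : ∀ Y ∈ symplecticDerivations Q e,
      g.symm.conjAlgEquiv ℂ Y ∈ symplecticDerivations Q e) :
    g.conjAlgEquiv ℂ (casimir Q e b) = casimir Q e b :=
  casimir_fixed (LinearMap.trace ℂ V) (fun p => symDerivation_mem Q e _ _)
    (fun p => Submodule.smul_mem _ _ (symDerivation_mem Q e _ _))
    (mul_ne_zero (by norm_num) h0) (reproducing_left e hb hκ) (reproducing_right e hb hκ)
    (g.conjAlgEquiv ℂ) (trace_conjAlgEquiv g) hg hg'

end CasimirOperator

/-! ### The Casimir element computed from the anticommutation relations. -/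

section CanonicalAnticommutation

variable {A : Type*} [Ring A] {ι : Type*} [Fintype ι] {c a : ι ⊕ ι → A}

lemma number_mul_annihilator [DecidableEq ι] (ha : ∀ x y, a x * a y = -(a y * a x))
    (hac : ∀ x y, a x * c y = (if x = y then 1 else 0) - c y * a x) (x : ι ⊕ ι) :
    (∑ y, c y * a y) * a x = a x * (∑ y, c y * a y) - a x := by
  have h : ∀ y, c y * a y * a x = a x * (c y * a y) - if x = y then a x else 0 := by
    intro y
    rw [mul_assoc, ha, ← mul_assoc (a x), hac]
    split_ifs with hxy
    · subst hxy; noncomm_ring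
    · noncomm_ring
  rw [Finset.sum_mul, Finset.mul_sum]
  simp only [h, Finset.sum_sub_distrib, Finset.sum_ite_eq, Finset.mem_univ, if_true]

lemma sum_creator_number_annihilator [DecidableEq ι] (ha : ∀ x y, a x * a y = -(a y * a x))
    (hac : ∀ x y, a x * c y = (if x = y then 1 else 0) - c y * a x) :
    ∑ x, c x * (∑ y, c y * a y) * a x =
      (∑ y, c y * a y) * (∑ y, c y * a y) - ∑ y, c y * a y := by
  simp only [mul_assoc, number_mul_annihilator ha hac, mul_sub, Finset.sum_sub_distrib]
  rw [Finset.sum_mul]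
  simp only [mul_assoc]

variable [Algebra ℂ A]

lemma sum_basisSign_mul (hc : ∀ x y, c x * c y = -(c y * c x)) :
    ∑ x, basisSign x • (c x * c x.swap) = (2 : ℂ) • ∑ i, c (Sum.inl i) * c (Sum.inr i) := by
  rw [Fintype.sum_sum_type, Finset.smul_sum, ← Finset.sum_add_distrib]
  refine Finset.sum_congr rfl fun i _ => ?_
  simp only [basisSign_inl, basisSign_inr, Sum.swap_inl, Sum.swap_inr]
  rw [hc (Sum.inr i)]
  module

lemma sum_basisSign_swap_mul (ha : ∀ x y, a x * a y = -(a y * a x)) :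
    ∑ x, basisSign x • (a x.swap * a x) = (2 : ℂ) • ∑ i, a (Sum.inr i) * a (Sum.inl i) := by
  rw [Fintype.sum_sum_type, Finset.smul_sum, ← Finset.sum_add_distrib]
  refine Finset.sum_congr rfl fun i _ => ?_
  simp only [basisSign_inl, basisSign_inr, Sum.swap_inl, Sum.swap_inr]
  rw [ha (Sum.inl i)]
  module

variable [DecidableEq ι]

/-- With N = ∑ c y * a y, the inner sum of annihilator times creator is 2·card ι − N, and N between
creators and annihilators sums to N² − N. -/
lemma sum_mul_swap_swap (ha : ∀ x y, a x * a y = -(a y * a x))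
    (hac : ∀ x y, a x * c y = (if x = y then 1 else 0) - c y * a x) :
    ∑ x : ι ⊕ ι, ∑ y : ι ⊕ ι, c x * a y.swap * c y.swap * a x =
      ((2 * Fintype.card ι + 1 : ℕ) : ℂ) • (∑ y, c y * a y) -
        (∑ y, c y * a y) * (∑ y, c y * a y) := by
  have h : ∀ x : ι ⊕ ι, ∑ y : ι ⊕ ι, c x * a y.swap * c y.swap * a x =
      ((2 * Fintype.card ι : ℕ) : ℂ) • (c x * a x) - c x * (∑ y, c y * a y) * a x := by
    intro x
    rw [← Equiv.sum_comp (Equiv.sumComm ι ι) (fun y => c y * a y), Finset.mul_sum,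
      Finset.sum_mul]
    simp only [mul_assoc (c x), hac, if_true, sub_mul, one_mul, mul_sub, Finset.sum_sub_distrib]
    simp [two_mul, Nat.cast_smul_eq_nsmul, add_smul]
  simp only [h, Finset.sum_sub_distrib, ← Finset.smul_sum, sum_creator_number_annihilator ha hac]
  rw [Nat.cast_add, Nat.cast_one, add_smul, one_smul]
  abel

/-- Moving the inner annihilator past the inner creator leaves the number operator from y = x and a
product of two signed sums. Each of these counts every pair twice, whence the 4. -/
lemma sum_mul_swap_twisted (hc : ∀ x y, c x * c y = -(c y * c x))
    (ha : ∀ x y, a x * a y = -(a y * a x))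
    (hac : ∀ x y, a x * c y = (if x = y then 1 else 0) - c y * a x) :
    ∑ x : ι ⊕ ι, ∑ y : ι ⊕ ι,
      (basisSign x * basisSign y) • (c x * a y.swap * c x.swap * a y) =
    ∑ y, c y * a y - (4 : ℂ) • ((∑ i, c (Sum.inl i) * c (Sum.inr i)) *
      ∑ i, a (Sum.inr i) * a (Sum.inl i)) := by
  have h4 : (4 : ℂ) • ((∑ i, c (Sum.inl i) * c (Sum.inr i)) *
      ∑ i, a (Sum.inr i) * a (Sum.inl i)) = ∑ x : ι ⊕ ι, ∑ y : ι ⊕ ι,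
      (basisSign x * basisSign y) • (c x * c x.swap * (a y.swap * a y)) := by
    have : (4 : ℂ) • ((∑ i, c (Sum.inl i) * c (Sum.inr i)) *
        ∑ i, a (Sum.inr i) * a (Sum.inl i)) = ((2 : ℂ) • ∑ i, c (Sum.inl i) * c (Sum.inr i)) *
        ((2 : ℂ) • ∑ i, a (Sum.inr i) * a (Sum.inl i)) := by
      rw [smul_mul_smul_comm]; norm_num
    rw [this, ← sum_basisSign_mul hc, ← sum_basisSign_swap_mul ha, Finset.sum_mul]
    refine Finset.sum_congr rfl fun x _ => ?_
    rw [Finset.mul_sum]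
    refine Finset.sum_congr rfl fun y _ => ?_
    rw [smul_mul_smul_comm]
  have hN : ∑ x, c x * a x = ∑ x : ι ⊕ ι, ∑ y : ι ⊕ ι, if y = x then c x * a x else 0 := by
    simp
  rw [h4, hN, ← Finset.sum_sub_distrib]
  refine Finset.sum_congr rfl fun x _ => ?_
  rw [← Finset.sum_sub_distrib]
  refine Finset.sum_congr rfl fun y _ => ?_
  rw [mul_assoc (c x) (a _), hac]
  by_cases hxy : y = x
  · subst hxy
    rw [if_pos rfl, if_pos rfl, basisSign_mul_self]
    simp only [one_smul]
    noncomm_ring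
  · have hne : y.swap ≠ x.swap := fun h => hxy (by
      rw [← Sum.swap_swap y, h, Sum.swap_swap])
    rw [if_neg hne, if_neg hxy, zero_sub, zero_sub, mul_neg, neg_mul, smul_neg]
    simp only [mul_assoc]

/-- The Casimir element of the symplectic Lie algebra realized by creators and annihilators. -/
lemma sum_casimir (hc : ∀ x y, c x * c y = -(c y * c x))
    (ha : ∀ x y, a x * a y = -(a y * a x))
    (hac : ∀ x y, a x * c y = (if x = y then 1 else 0) - c y * a x) :
    ∑ x : ι ⊕ ι, ∑ y : ι ⊕ ι, (basisSign x * basisSign y) •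
      ((basisSign y • (c x * a y.swap) + basisSign x • (c y * a x.swap)) *
        (basisSign y.swap • (c x.swap * a y.swap.swap) +
          basisSign x.swap • (c y.swap * a x.swap.swap))) =
    (8 : ℂ) • ((∑ i, c (Sum.inl i) * c (Sum.inr i)) * ∑ i, a (Sum.inr i) * a (Sum.inl i)) +
      (2 : ℂ) • ((∑ y, c y * a y) * (∑ y, c y * a y)) -
      ((4 * Fintype.card ι + 4 : ℕ) : ℂ) • ∑ y, c y * a y := by
  -- The product expands into the two kinds of summands evaluated above, each occurring twice up to
  -- exchanging x and y.
  have h : ∀ x y : ι ⊕ ι, (basisSign x * basisSign y) •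
      ((basisSign y • (c x * a y.swap) + basisSign x • (c y * a x.swap)) *
        (basisSign y.swap • (c x.swap * a y.swap.swap) +
          basisSign x.swap • (c y.swap * a x.swap.swap))) =
      -((basisSign x * basisSign y) • (c x * a y.swap * c x.swap * a y) +
        c x * a y.swap * c y.swap * a x +
        (c y * a x.swap * c x.swap * a y +
        (basisSign y * basisSign x) • (c y * a x.swap * c y.swap * a x))) := by
    intro x y
    simp only [Sum.swap_swap, basisSign_swap, add_mul, mul_add, smul_add,
      smul_mul_smul_comm, smul_smul, mul_assoc]
    rcases x with x | x <;> rcases y with y | y <;>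
      simp only [basisSign_inl, basisSign_inr] <;> module
  simp only [h, Finset.sum_neg_distrib, Finset.sum_add_distrib]
  rw [Finset.sum_comm (f := fun x y : ι ⊕ ι => c y * a x.swap * c x.swap * a y),
    Finset.sum_comm (f := fun x y : ι ⊕ ι =>
      (basisSign y * basisSign x) • (c y * a x.swap * c y.swap * a x)),
    sum_mul_swap_swap ha hac, sum_mul_swap_twisted hc ha hac]
  push_cast
  module

end CanonicalAnticommutation

/-! ### The Casimir operator in terms of the Lefschetz operators. -/

section Lefschetz

variable {W : Type*} [AddCommGroup W] [Module ℂ W] {ι : Type*} [Fintype ι]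
  (b : Module.Basis (ι ⊕ ι) ℂ W)

/-- Exterior multiplication by the symplectic bivector. -/
noncomputable def lefschetz : Module.End ℂ (ExteriorAlgebra ℂ W) :=
  ∑ i, create (b (Sum.inl i)) * create (b (Sum.inr i))

/-- Contraction with the symplectic form. -/
noncomputable def dualLefschetz : Module.End ℂ (ExteriorAlgebra ℂ W) :=
  ∑ i, annihilate (b.coord (Sum.inr i)) * annihilate (b.coord (Sum.inl i))

/-- The degree operator. -/
noncomputable def number : Module.End ℂ (ExteriorAlgebra ℂ W) :=
  ∑ x, create (b x) * annihilate (b.coord x)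

lemma sum_rootOperator [DecidableEq ι] : ∑ x : ι ⊕ ι, ∑ y : ι ⊕ ι,
      (basisSign x * basisSign y) • (rootOperator b x y * rootOperator b x.swap y.swap) =
    (8 : ℂ) • (lefschetz b * dualLefschetz b) + (2 : ℂ) • (number b * number b) -
      ((4 * Fintype.card ι + 4 : ℕ) : ℂ) • number b :=
  sum_casimir (A := Module.End ℂ (ExteriorAlgebra ℂ W)) (c := fun x => create (b x))
    (a := fun x => annihilate (b.coord x))
    (fun x y => LinearMap.ext fun z => create_anticomm (b x) (b y) z)
    (fun x y => LinearMap.ext fun z => annihilate_anticomm (b.coord x) (b.coord y) z)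
    (fun x y => LinearMap.ext fun z => by
      rw [Module.End.mul_apply, annihilate_coord_create]
      split_ifs <;> simp)

variable {b} {Q : LinearMap.BilinForm ℂ W}

lemma number_apply_of_mem {n : ℕ} {z : ExteriorAlgebra ℂ W} (hz : z ∈ ⋀[ℂ]^n W) :
    number b z = (n : ℂ) • z := by
  classical
  rw [← sum_number_of_mem b hz, number, LinearMap.sum_apply]
  rfl

/-- On `⋀ⁿ W` the Casimir operator is an affine function of the product of the Lefschetz
operators. -/
lemma toAlgebra_casimir [DecidableEq ι] (hb : IsSymplecticFamily Q b) {n : ℕ}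
    {V : Type*} [AddCommGroup V] [Module ℂ V] (e : V ≃ₗ[ℂ] ⋀[ℂ]^n W) (z : V) :
    toAlgebra e (casimir Q e b z) = (8 : ℂ) • lefschetz b (dualLefschetz b (toAlgebra e z)) +
      (2 * (n : ℂ) ^ 2 - (4 * Fintype.card ι + 4) * n) • toAlgebra e z := by
  have h : toAlgebra e (casimir Q e b z) = (∑ x : ι ⊕ ι, ∑ y : ι ⊕ ι,
      (basisSign x * basisSign y) •
      (rootOperator b x y * rootOperator b x.swap y.swap)) (toAlgebra e z) := by
    rw [casimir, Fintype.sum_prod_type]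
    simp only [LinearMap.sum_apply, map_sum, Module.End.mul_apply, LinearMap.smul_apply, map_smul,
      hb.toAlgebra_symDerivation]
  rw [h, sum_rootOperator]
  simp only [LinearMap.sub_apply, LinearMap.add_apply, LinearMap.smul_apply,
    Module.End.mul_apply, number_apply_of_mem (toAlgebra_mem e z), map_smul, smul_smul]
  push_cast
  module

end Lefschetz

/-! ### Exchange argument for finite sets. -/

section Exchange

variable {ι : Type*} [DecidableEq ι]

/-- A property of finite sets that is stable under exchanges of elements, inside `K` or outside
`K`, passes from a set to every set with the same number of elements inside and outside `K`. -/
lemma exchange_induction {K O : Finset ι} {p : Finset ι → Prop}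
    (hp : ∀ A i j, Disjoint A O → i ∈ A → j ∉ A → j ∉ O → (i ∈ K ↔ j ∈ K) → p A →
      p (insert j (A.erase i)))
    {A' : Finset ι} (hA' : Disjoint A' O) :
    ∀ (m : ℕ) (A : Finset ι), (A \ A').card = m → Disjoint A O → A.card = A'.card →
      (A ∩ K).card = (A' ∩ K).card → p A → p A' := by
  intro m
  induction m with
  | zero =>
    intro A hm _ hcard _ h
    rw [Finset.card_eq_zero, Finset.sdiff_eq_empty_iff_subset] at hm
    rwa [← Finset.eq_of_subset_of_card_le hm hcard.ge]
  | succ m ih =>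
    intro A hm hA hcard hK h
    obtain ⟨i, hi⟩ : (A \ A').Nonempty := by rw [← Finset.card_pos]; omega
    rw [Finset.mem_sdiff] at hi
    -- Otherwise `A'` would have fewer elements than `A` on the side of `K` containing i.
    obtain ⟨j, hjA', hjA, hij⟩ : ∃ j, j ∈ A' ∧ j ∉ A ∧ (i ∈ K ↔ j ∈ K) := by
      by_cases hiK : i ∈ K
      · by_contra! hcon
        have hsub : A' ∩ K ⊆ (A ∩ K).erase i := by
          intro j hj
          rw [Finset.mem_inter] at hj
          rw [Finset.mem_erase, Finset.mem_inter]
          refine ⟨fun h => hi.2 (h ▸ hj.1), ?_, hj.2⟩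
          by_contra hjA
          rcases hcon j hj.1 hjA with h' | h'
          · exact h'.2 hj.2
          · exact h'.1 hiK
        have h1 := Finset.card_le_card hsub
        have h2 : i ∈ A ∩ K := Finset.mem_inter.mpr ⟨hi.1, hiK⟩
        rw [Finset.card_erase_of_mem h2] at h1
        have := Finset.card_pos.mpr ⟨i, h2⟩
        omega
      · by_contra! hcon
        have hsub : A' \ K ⊆ (A \ K).erase i := by
          intro j hj
          rw [Finset.mem_sdiff] at hj
          rw [Finset.mem_erase, Finset.mem_sdiff]
          refine ⟨fun h => hi.2 (h ▸ hj.1), ?_, hj.2⟩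
          by_contra hjA
          rcases hcon j hj.1 hjA with h' | h'
          · exact hiK h'.1
          · exact hj.2 h'.2
        have h1 := Finset.card_le_card hsub
        have h2 : i ∈ A \ K := Finset.mem_sdiff.mpr ⟨hi.1, hiK⟩
        rw [Finset.card_erase_of_mem h2] at h1
        have h3 := Finset.card_pos.mpr ⟨i, h2⟩
        have h4 := Finset.card_inter_add_card_sdiff A K
        have h5 := Finset.card_inter_add_card_sdiff A' K
        omega
    have hjO : j ∉ O := Finset.disjoint_left.mp hA' hjA'
    have hiO : i ∉ O := Finset.disjoint_left.mp hA hi.1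
    refine ih (insert j (A.erase i)) ?_ ?_ ?_ ?_ (hp A i j hA hi.1 hjA hjO hij h)
    · have : insert j (A.erase i) \ A' = (A \ A').erase i := by
        ext t; simp only [Finset.mem_sdiff, Finset.mem_insert, Finset.mem_erase]; grind
      rw [this, Finset.card_erase_of_mem (Finset.mem_sdiff.mpr hi), hm]
      rfl
    · rw [Finset.disjoint_insert_left]
      exact ⟨hjO, hA.mono_left (Finset.erase_subset _ _)⟩
    · rw [Finset.card_insert_of_notMem (fun h => hjA (Finset.mem_of_mem_erase h)),
        Finset.card_erase_of_mem hi.1, ← hcard]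
      have := Finset.card_pos.mpr ⟨i, hi.1⟩
      omega
    · rw [← hK]
      by_cases hiK : i ∈ K
      · have hjK := hij.mp hiK
        have : insert j (A.erase i) ∩ K = insert j ((A ∩ K).erase i) := by
          ext t; simp only [Finset.mem_inter, Finset.mem_insert, Finset.mem_erase]; grind
        have h2 : i ∈ A ∩ K := Finset.mem_inter.mpr ⟨hi.1, hiK⟩
        rw [this, Finset.card_insert_of_notMem (by simp [hjA]), Finset.card_erase_of_mem h2]
        have := Finset.card_pos.mpr ⟨i, h2⟩
        omega
      · have hjK : j ∉ K := fun h => hiK (hij.mpr h)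
        congr 1
        ext t; simp only [Finset.mem_inter, Finset.mem_insert, Finset.mem_erase]; grind

end Exchange

lemma swap_injective {ι : Type*} {x y : ι ⊕ ι} (h : x.swap = y.swap) : x = y := by
  rw [← Sum.swap_swap x, h, Sum.swap_swap]

/-! ### Paired monomials generate the exterior power. -/

section Generation

variable {W : Type*} [AddCommGroup W] [Module ℂ W] {ι : Type*} [DecidableEq ι]
  {b : Module.Basis (ι ⊕ ι) ℂ W} {Y : Submodule ℂ (ExteriorAlgebra ℂ W)}

lemma mem_of_smul_mem_of_ne_zero {M : Type*} [AddCommGroup M] [Module ℂ M] (Y : Submodule ℂ M)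
    {c : ℂ} (hc : c ≠ 0) {z : M} (h : c • z ∈ Y) : z ∈ Y :=
  (Submodule.smul_mem_iff Y hc).mp h

/-- The operator trades `y.swap` for x; its other term would remove `x.swap`, which is absent. When
y ∈ I, this breaks the pair of y and `y.swap` into the unpaired x and y. -/
lemma split_mem (hY : ∀ x y, ∀ u ∈ Y, rootOperator b x y u ∈ Y) {x y : ι ⊕ ι}
    {I : Finset (ι ⊕ ι)} (hxy : x ≠ y) (hx : x ∈ I) (hx' : x.swap ∉ I)
    (hy' : y.swap ∉ I) (h : wedgeBasis b (insert y.swap (I.erase x)) ∈ Y) :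
    wedgeBasis b I ∈ Y := by
  have h1 := hY x y _ h
  have hxy' : x ≠ y.swap := fun h => hy' (h ▸ hx)
  rw [rootOperator_apply, create_annihilate_wedgeBasis_of_notMem b (b y) (y := x.swap), smul_zero,
    add_zero] at h1
  · obtain ⟨ε, hε, h2⟩ := create_annihilate_wedgeBasis b (x := x) (y := y.swap)
      (I := insert y.swap (I.erase x)) (by simp [hxy']) (Finset.mem_insert_self _ _)
    have h3 : insert x ((insert y.swap (I.erase x)).erase y.swap) = I := by
      rw [Finset.erase_insert (by simp [hy']), Finset.insert_erase hx]
    rw [h2, h3, smul_smul] at h1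
    exact mem_of_smul_mem_of_ne_zero Y (mul_ne_zero (basisSign_ne_zero _) hε) h1
  · simp only [Finset.mem_insert, Finset.mem_erase, not_or, not_and]
    exact ⟨fun h => hxy (swap_injective h), fun _ => hx'⟩

/-- The operator of `x.swap` and `y.swap` produces both monomials at once, so one of them yields the
other. -/
lemma recombine_mem (hY : ∀ x y, ∀ u ∈ Y, rootOperator b x y u ∈ Y) {x y : ι ⊕ ι}
    {I : Finset (ι ⊕ ι)} (hx : x ∈ I) (hy : y ∈ I) (hx' : x.swap ∉ I)
    (hy' : y.swap ∉ I) (h : wedgeBasis b I ∈ Y)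
    (h' : wedgeBasis b (insert y.swap (I.erase x)) ∈ Y) :
    wedgeBasis b (insert x.swap (I.erase y)) ∈ Y := by
  have h1 := hY x.swap y.swap _ h
  obtain ⟨ε, hε, h2⟩ := create_annihilate_wedgeBasis b hx' hy
  obtain ⟨δ, hδ, h3⟩ := create_annihilate_wedgeBasis b hy' hx
  rw [rootOperator_apply, Sum.swap_swap, Sum.swap_swap, h2, h3, smul_smul, smul_smul] at h1
  have h4 := (Submodule.add_mem_iff_left Y (Submodule.smul_mem Y _ h')).mp h1
  exact mem_of_smul_mem_of_ne_zero Y (mul_ne_zero (basisSign_ne_zero _) hε) h4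

lemma flip_mem (hY : ∀ x y, ∀ u ∈ Y, rootOperator b x y u ∈ Y) {x : ι ⊕ ι}
    {I : Finset (ι ⊕ ι)} (hx : x ∈ I) (hx' : x.swap ∉ I) (h : wedgeBasis b I ∈ Y) :
    wedgeBasis b (insert x.swap (I.erase x)) ∈ Y := by
  have h1 := hY x.swap x.swap _ h
  obtain ⟨ε, hε, h2⟩ := create_annihilate_wedgeBasis b hx' hx
  rw [rootOperator_apply, Sum.swap_swap, h2, smul_smul, ← add_smul, ← two_mul] at h1
  exact mem_of_smul_mem_of_ne_zero Y
    (mul_ne_zero two_ne_zero (mul_ne_zero (basisSign_ne_zero _) hε)) h1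

lemma move_single_mem (hY : ∀ x y, ∀ u ∈ Y, rootOperator b x y u ∈ Y) {x y : ι ⊕ ι}
    {I : Finset (ι ⊕ ι)} (hx : x ∈ I) (hy : y ∉ I) (hy' : y.swap ∉ I)
    (h : wedgeBasis b I ∈ Y) : wedgeBasis b (insert y (I.erase x)) ∈ Y := by
  have h1 := hY y x.swap _ h
  obtain ⟨ε, hε, h2⟩ := create_annihilate_wedgeBasis b hy hx
  rw [rootOperator_apply, Sum.swap_swap, h2,
    create_annihilate_wedgeBasis_of_notMem b (b x.swap) hy', smul_zero, add_zero, smul_smul] at h1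
  exact mem_of_smul_mem_of_ne_zero Y (mul_ne_zero (basisSign_ne_zero _) hε) h1

/-- The other term vanishes because it creates y, already present. For an unpaired x in I, x gains
its partner and y loses its own. -/
lemma exchange_single_mem (hY : ∀ x y, ∀ u ∈ Y, rootOperator b x y u ∈ Y) {x y : ι ⊕ ι}
    {I : Finset (ι ⊕ ι)} (hx' : x.swap ∉ I) (hy : y ∈ I) (hy' : y.swap ∈ I)
    (h : wedgeBasis b I ∈ Y) : wedgeBasis b (insert x.swap (I.erase y.swap)) ∈ Y := by
  have h1 := hY x.swap y _ h
  obtain ⟨ε, hε, h2⟩ := create_annihilate_wedgeBasis b hx' hy'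
  have hyx : y ≠ x := fun h => hx' (h ▸ hy')
  rw [rootOperator_apply, Sum.swap_swap, h2,
    create_annihilate_wedgeBasis_of_mem_of_ne b hy hyx, smul_zero, add_zero, smul_smul] at h1
  exact mem_of_smul_mem_of_ne_zero Y (mul_ne_zero (basisSign_ne_zero _) hε) h1

/-- Break pair i by replacing eᵢ with eⱼ. From there one operator produces both the original
monomial and the one with pair j, so `recombine_mem` applies. -/
lemma exchange_pair_mem (hY : ∀ x y, ∀ u ∈ Y, rootOperator b x y u ∈ Y) {i j : ι}
    {I : Finset (ι ⊕ ι)} (hi : Sum.inl i ∈ I) (hi' : Sum.inr i ∈ I) (hj : Sum.inl j ∉ I)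
    (hj' : Sum.inr j ∉ I) (h : wedgeBasis b I ∈ Y) :
    wedgeBasis b (insert (Sum.inr j) ((insert (Sum.inl j) (I.erase (Sum.inl i))).erase
      (Sum.inr i))) ∈ Y := by
  have hij : i ≠ j := fun h => hj (h ▸ hi)
  have hback : insert (Sum.inl i) ((insert (Sum.inl j) (I.erase (Sum.inl i))).erase
      (Sum.inl j)) = I := by
    rw [Finset.erase_insert (by simp [hj]), Finset.insert_erase hi]
  have h1 : wedgeBasis b (insert (Sum.inl j) (I.erase (Sum.inl i))) ∈ Y := by
    refine split_mem hY (x := Sum.inl j) (y := Sum.inr i) (by simp) (by simp)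
      (by simp [hj']) (by simp [hij]) ?_
    rw [Sum.swap_inr, hback]
    exact h
  refine recombine_mem hY (x := Sum.inl j) (y := Sum.inr i) (by simp) (by simp [hi'])
      (by simp [hj']) (by simp [hij]) h1 ?_
  rw [Sum.swap_inr, hback]
  exact h

lemma exchange_disjSum_mem (hY : ∀ x y, ∀ u ∈ Y, rootOperator b x y u ∈ Y)
    {A B O : Finset ι} (hA : Disjoint A O) (hB : Disjoint B O) (hcard : A.card = B.card)
    (h : wedgeBasis b ((A ∪ O).disjSum A) ∈ Y) : wedgeBasis b ((B ∪ O).disjSum B) ∈ Y := by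
  refine exchange_induction (K := ∅) (O := O)
    (p := fun A => wedgeBasis b ((A ∪ O).disjSum A) ∈ Y) ?_ hB _ A rfl hA hcard (by simp) h
  intro A i j hA hi hjA hjO _ h
  have hiO := Finset.disjoint_left.mp hA hi
  have h1 := exchange_pair_mem hY (i := i) (j := j) (by simp [hi]) (by simp [hi])
    (by simp [hjA, hjO]) (by simp [hjA]) h
  convert h1 using 2
  ext t
  rcases t with t | t <;> simp <;> grind

/-- The unpaired index is moved from o' to o, directly if o is free and by trading with pair o if o
∈ K; afterwards only pairs need exchanging. -/
lemma single_mem (hY : ∀ x y, ∀ u ∈ Y, rootOperator b x y u ∈ Y) {K A : Finset ι} {o' o : ι}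
    (hK : o' ∉ K) (hA : o ∉ A) (hcard : A.card = K.card)
    (h : wedgeBasis b ((K ∪ {o'}).disjSum K) ∈ Y) :
    wedgeBasis b ((A ∪ {o}).disjSum A) ∈ Y := by
  have hA' : Disjoint A {o} := Finset.disjoint_singleton_right.mpr hA
  by_cases ho : o = o'
  · subst ho
    exact exchange_disjSum_mem hY (Finset.disjoint_singleton_right.mpr hK) hA' hcard.symm h
  by_cases hoK : o ∈ K
  · have h1 := exchange_single_mem hY (x := Sum.inl o') (y := Sum.inl o)
      (by simp [hK]) (by simp [hoK]) (by simp [hoK]) h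
    refine exchange_disjSum_mem hY (A := insert o' (K.erase o)) ?_ hA' ?_ ?_
    · simp [ho]
    · rw [Finset.card_insert_of_notMem (by simp [hK]), Finset.card_erase_of_mem hoK, hcard]
      have := Finset.card_pos.mpr ⟨o, hoK⟩
      omega
    · convert h1 using 2
      ext t
      rcases t with t | t <;> simp <;> grind
  · have h1 := move_single_mem hY (x := Sum.inl o') (y := Sum.inl o)
      (by simp) (by simp [hoK, ho]) (by simp [hoK]) h
    refine exchange_disjSum_mem hY (A := K) (Finset.disjoint_singleton_right.mpr hoK) hA'
      hcard.symm ?_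
    convert h1 using 2
    ext t
    rcases t with t | t <;> simp <;> grind

lemma single_inr_mem (hY : ∀ x y, ∀ u ∈ Y, rootOperator b x y u ∈ Y) {A : Finset ι} {o : ι}
    (hA : o ∉ A) (h : wedgeBasis b ((A ∪ {o}).disjSum A) ∈ Y) :
    wedgeBasis b (A.disjSum (A ∪ {o})) ∈ Y := by
  have h1 := flip_mem hY (x := Sum.inl o) (by simp) (by simpa using hA) h
  convert h1 using 2
  ext t
  rcases t with t | t
  · have : t ∈ A → t ≠ o := fun h h' => hA (h' ▸ h)
    simp only [Finset.inl_mem_disjSum, Sum.swap_inl, Finset.mem_insert, Finset.mem_erase,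
      Finset.mem_union, Finset.mem_singleton, ne_eq, Sum.inl.injEq, reduceCtorEq, false_or]
    tauto
  · simp

lemma filter_insert_erase_subset {I : Finset (ι ⊕ ι)} {x y : ι ⊕ ι} (hx : x ∈ I)
    (hx' : x.swap ∉ I) (hy : y ∈ I) (hxy : x ≠ y) :
    ((insert y.swap (I.erase x)).filter fun t => t.swap ∉ insert y.swap (I.erase x)) ⊆
      (I.filter fun t => t.swap ∉ I).erase x := by
  intro t ht
  rw [Finset.mem_filter, Finset.mem_insert, Finset.mem_insert, Finset.mem_erase,
    Finset.mem_erase, not_or, not_and] at ht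
  rw [Finset.mem_erase, Finset.mem_filter]
  obtain ⟨ht1, ht2, ht3⟩ := ht
  rcases ht1 with rfl | ⟨h1, h2⟩
  · rw [Sum.swap_swap] at ht3
    exact absurd hy (ht3 hxy.symm)
  · refine ⟨h1, h2, fun h => ht3 ?_ h⟩
    rintro rfl
    exact hx' (by rwa [Sum.swap_swap])

/-- The monomial of a maximally paired index set generates all monomials of its degree under
the symplectic Lie algebra. -/
lemma wedgeBasis_mem_of_card (hY : ∀ x y, ∀ u ∈ Y, rootOperator b x y u ∈ Y)
    {K O : Finset ι} (hKO : Disjoint K O) (hO : O.card ≤ 1)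
    (h : wedgeBasis b ((K ∪ O).disjSum K) ∈ Y) :
    ∀ (m : ℕ) (I : Finset (ι ⊕ ι)), (I.filter fun x => x.swap ∉ I).card = m →
      I.card = 2 * K.card + O.card → wedgeBasis b I ∈ Y := by
  intro m
  induction m using Nat.strong_induction_on with
  | _ m ih =>
  intro I hm hcard
  -- With two unpaired elements x and y, replacing x by `y.swap` pairs y off and lowers the number
  -- of unpaired elements.
  by_cases hm2 : 1 < m
  · rw [← hm] at hm2
    obtain ⟨x, hx, y, hy, hxy⟩ := Finset.one_lt_card.mp hm2
    rw [Finset.mem_filter] at hx hy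
    refine split_mem hY hxy hx.1 hx.2 hy.2 (ih _ ?_ _ rfl ?_)
    · rw [← hm]
      refine lt_of_le_of_lt (Finset.card_le_card (t := (I.filter fun x => x.swap ∉ I).erase x) ?_)
        (Finset.card_erase_lt_of_mem (Finset.mem_filter.mpr hx))
      exact filter_insert_erase_subset hx.1 hx.2 hy.1 hxy
    · rw [Finset.card_insert_of_notMem (by simp [hy.2]), Finset.card_erase_of_mem hx.1, ← hcard]
      have := Finset.card_pos.mpr ⟨x, hx.1⟩
      omega
  have hcard' : I.toLeft.card + I.toRight.card = I.card := Finset.card_toLeft_add_card_toRight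
  have hI : I.toLeft.disjSum I.toRight = I := Finset.toLeft_disjSum_toRight
  rcases Nat.eq_zero_or_pos m with h0 | h0
  · subst h0
    rw [Finset.card_eq_zero, Finset.filter_eq_empty_iff] at hm
    have hLR : I.toLeft = I.toRight := by
      ext i
      have h1 := @hm (Sum.inl i)
      have h2 := @hm (Sum.inr i)
      simp only [Sum.swap_inl, Sum.swap_inr, not_not] at h1 h2
      rw [Finset.mem_toLeft, Finset.mem_toRight]
      exact ⟨h1, h2⟩
    rw [hLR] at hcard' hI
    -- The cardinality is even here; in the remaining case it is odd, forcing `O` to be a singleton.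
    obtain rfl : O = ∅ := by rw [← Finset.card_eq_zero]; omega
    rw [Finset.card_empty] at hcard
    have h1 := exchange_disjSum_mem hY hKO (Finset.disjoint_empty_right I.toRight) (by omega) h
    rwa [Finset.union_empty, hI] at h1
  · obtain ⟨x, hx⟩ := Finset.card_eq_one.mp (hm.trans (show m = 1 by omega))
    have hx1 : ∀ t, (t ∈ I ∧ t.swap ∉ I) ↔ t = x := by
      intro t
      rw [← Finset.mem_singleton, ← hx, Finset.mem_filter]
    have hxI := (hx1 x).mpr rfl
    obtain ⟨i, hi⟩ | ⟨i, hi⟩ : (∃ i, x = Sum.inl i) ∨ ∃ i, x = Sum.inr i := by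
      rcases x with i | i
      · exact Or.inl ⟨i, rfl⟩
      · exact Or.inr ⟨i, rfl⟩
    · subst hi
      have hiA : i ∉ I.toRight := by rw [Finset.mem_toRight]; exact hxI.2
      have hL : I.toLeft = I.toRight ∪ {i} := by
        ext j
        have h1 := hx1 (Sum.inl j)
        have h2 := hx1 (Sum.inr j)
        simp only [Sum.swap_inl, Sum.swap_inr, Sum.inl.injEq, reduceCtorEq] at h1 h2
        simp only [Finset.mem_toLeft, Finset.mem_toRight, Finset.mem_union,
          Finset.mem_singleton]
        tauto
      have hLc : I.toLeft.card = I.toRight.card + 1 := by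
        rw [hL, Finset.card_union_of_disjoint (Finset.disjoint_singleton_right.mpr hiA),
          Finset.card_singleton]
      obtain ⟨o, rfl⟩ := Finset.card_eq_one.mp (show O.card = 1 by omega)
      rw [Finset.card_singleton] at hcard
      have h1 := single_mem hY (A := I.toRight) (Finset.disjoint_singleton_right.mp hKO) hiA
        (by omega) h
      rwa [← hL, hI] at h1
    · subst hi
      have hiA : i ∉ I.toLeft := by rw [Finset.mem_toLeft]; exact hxI.2
      have hR : I.toRight = I.toLeft ∪ {i} := by
        ext j
        have h1 := hx1 (Sum.inl j)
        have h2 := hx1 (Sum.inr j)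
        simp only [Sum.swap_inl, Sum.swap_inr, Sum.inr.injEq, reduceCtorEq] at h1 h2
        simp only [Finset.mem_toLeft, Finset.mem_toRight, Finset.mem_union,
          Finset.mem_singleton]
        tauto
      have hRc : I.toRight.card = I.toLeft.card + 1 := by
        rw [hR, Finset.card_union_of_disjoint (Finset.disjoint_singleton_right.mpr hiA),
          Finset.card_singleton]
      obtain ⟨o, rfl⟩ := Finset.card_eq_one.mp (show O.card = 1 by omega)
      rw [Finset.card_singleton] at hcard
      have h1 := single_mem hY (A := I.toLeft) (Finset.disjoint_singleton_right.mp hKO) hiA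
        (by omega) h
      have h2 := single_inr_mem hY hiA h1
      rwa [← hR, hI] at h2

end Generation

/-! ### Paired vectors and the Lefschetz operators on them. -/

section PairVectors

variable {W : Type*} [AddCommGroup W] [Module ℂ W] {ι : Type*}
  (b : Module.Basis (ι ⊕ ι) ℂ W)

lemma commute_create_create (i j : ι) :
    Commute (create (b (Sum.inl i)) * create (b (Sum.inr i)))
      (create (b (Sum.inl j)) * create (b (Sum.inr j))) := by
  refine LinearMap.ext fun z => ?_
  simp only [Module.End.mul_apply]
  rw [create_anticomm (b (Sum.inr i)), map_neg, create_anticomm (b (Sum.inl i)), neg_neg,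
    create_anticomm (b (Sum.inr i)), map_neg, map_neg, create_anticomm (b (Sum.inl i)), map_neg,
    neg_neg]

lemma pairwise_commute_create_create (A : Finset ι) : (A : Set ι).Pairwise (Function.onFun Commute
    fun i => create (b (Sum.inl i)) * create (b (Sum.inr i))) :=
  fun i _ j _ _ => commute_create_create b i j

/-- The product of the bivectors `eᵢ ∧ fᵢ` for `i ∈ A` and the vectors `eᵢ` for `i ∈ O`. -/
noncomputable def pairVector (O A : Finset ι) : ExteriorAlgebra ℂ W :=
  A.noncommProd (fun i => create (b (Sum.inl i)) * create (b (Sum.inr i)))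
    (pairwise_commute_create_create b A) (wedgeBasis b (O.disjSum ∅))

section

variable [Fintype ι] {b}

lemma herm_sum_left {κ : Type*} (s : Finset κ) (u : κ → ExteriorAlgebra ℂ W)
    (v : ExteriorAlgebra ℂ W) : herm b (∑ k ∈ s, u k) v = ∑ k ∈ s, herm b (u k) v := by
  rw [← herm_conj, map_sum, map_sum]
  simp only [herm_conj]

lemma herm_lefschetz_left (u v : ExteriorAlgebra ℂ W) :
    herm b (lefschetz b u) v = herm b u (dualLefschetz b v) := by
  rw [lefschetz, dualLefschetz, LinearMap.sum_apply, LinearMap.sum_apply, map_sum, herm_sum_left]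
  simp only [Module.End.mul_apply, herm_create_left]

lemma herm_dualLefschetz_left (u v : ExteriorAlgebra ℂ W) :
    herm b (dualLefschetz b u) v = herm b u (lefschetz b v) := by
  rw [← herm_conj, ← herm_lefschetz_left, herm_conj]

end

variable [DecidableEq ι]

lemma pairVector_insert (O : Finset ι) {A : Finset ι} {i : ι} (hi : i ∉ A) :
    pairVector b O (insert i A) =
      create (b (Sum.inl i)) (create (b (Sum.inr i)) (pairVector b O A)) := by
  rw [pairVector, Finset.noncommProd_insert_of_notMem _ _ _ _ hi]
  rfl

/-- Signs enter only in this comparison with monomials: as the bivectors commute, L and Λ act on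
paired vectors with all coefficients 1. -/
lemma pairVector_eq {O A : Finset ι} (hA : Disjoint A O) :
    ∃ ε : ℂ, (ε = 1 ∨ ε = -1) ∧ pairVector b O A = ε • wedgeBasis b ((A ∪ O).disjSum A) := by
  induction A using Finset.induction_on with
  | empty => exact ⟨1, Or.inl rfl, by simp [pairVector, Finset.noncommProd_empty]⟩
  | insert i A hi ih =>
    rw [Finset.disjoint_insert_left] at hA
    obtain ⟨ε, hε, h⟩ := ih hA.2
    obtain ⟨δ, hδ, h1⟩ := create_wedgeBasis b (x := Sum.inr i) (I := (A ∪ O).disjSum A)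
      (by simp [hi])
    obtain ⟨γ, hγ, h2⟩ := create_wedgeBasis b (x := Sum.inl i)
      (I := insert (Sum.inr i) ((A ∪ O).disjSum A)) (by simp [hi, hA.1])
    have h3 : insert (Sum.inl i) (insert (Sum.inr i) ((A ∪ O).disjSum A)) =
        (insert i A ∪ O).disjSum (insert i A) := by
      ext t
      rcases t with t | t <;> simp
    refine ⟨ε * δ * γ, ?_, ?_⟩
    · rcases hε with rfl | rfl <;> rcases hδ with rfl | rfl <;> rcases hγ with rfl | rfl <;> simp
    · rw [pairVector_insert b O hi, h, map_smul, h1, map_smul, map_smul, h2, h3, smul_smul,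
        smul_smul]

variable {b} {O A : Finset ι}

lemma create_inl_pairVector (hA : Disjoint A O) {i : ι} (hi : i ∈ A ∪ O) :
    create (b (Sum.inl i)) (pairVector b O A) = 0 := by
  obtain ⟨ε, -, h⟩ := pairVector_eq b hA
  rw [h, map_smul, create_wedgeBasis_of_mem b (Finset.inl_mem_disjSum.mpr hi), smul_zero]

lemma annihilate_inl_pairVector (hA : Disjoint A O) {i : ι} (hi : i ∉ A) (hiO : i ∉ O) :
    annihilate (b.coord (Sum.inl i)) (pairVector b O A) = 0 := by
  obtain ⟨ε, -, h⟩ := pairVector_eq b hA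
  rw [h, map_smul, annihilate_wedgeBasis_of_notMem b (by simp [hi, hiO]), smul_zero]

lemma annihilate_inr_pairVector (hA : Disjoint A O) {i : ι} (hi : i ∉ A) :
    annihilate (b.coord (Sum.inr i)) (pairVector b O A) = 0 := by
  obtain ⟨ε, -, h⟩ := pairVector_eq b hA
  rw [h, map_smul, annihilate_wedgeBasis_of_notMem b (by simp [hi]), smul_zero]

lemma disjoint_erase (hA : Disjoint A O) (i : ι) : Disjoint (A.erase i) O :=
  hA.mono_left (Finset.erase_subset _ _)

lemma disjoint_insert (hA : Disjoint A O) {i : ι} (hi : i ∉ O) : Disjoint (insert i A) O := by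
  rw [Finset.disjoint_insert_left]
  exact ⟨hi, hA⟩

variable [Fintype ι]

lemma herm_pairVector {A' : Finset ι} (hA : Disjoint A O) (hA' : Disjoint A' O) :
    herm b (pairVector b O A) (pairVector b O A') = if A = A' then 1 else 0 := by
  obtain ⟨ε, hε, h⟩ := pairVector_eq b hA
  split_ifs with hAA
  · subst hAA
    rw [h, herm_smul_left, map_smul, herm_wedgeBasis, if_pos rfl]
    rcases hε with rfl | rfl <;> simp
  · obtain ⟨δ, hδ, h'⟩ := pairVector_eq b hA'
    rw [h, h', herm_smul_left, map_smul, herm_wedgeBasis, if_neg]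
    · simp
    · intro h1
      refine hAA (Finset.ext fun i => ?_)
      rw [← Finset.inr_mem_disjSum (s := A ∪ O), h1, Finset.inr_mem_disjSum]

lemma lefschetz_pairVector (hA : Disjoint A O) : lefschetz b (pairVector b O A) =
    ∑ i ∈ Finset.univ.filter (fun i => i ∉ A ∧ i ∉ O), pairVector b O (insert i A) := by
  rw [lefschetz, LinearMap.sum_apply, Finset.sum_filter]
  refine Finset.sum_congr rfl fun i _ => ?_
  rw [Module.End.mul_apply]
  split_ifs with hi
  · rw [pairVector_insert b O hi.1]
  · rw [create_anticomm, create_inl_pairVector hA, map_zero, neg_zero]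
    rw [Finset.mem_union]
    tauto

lemma dualLefschetz_pairVector (hA : Disjoint A O) : dualLefschetz b (pairVector b O A) =
    ∑ i ∈ A, pairVector b O (A.erase i) := by
  rw [dualLefschetz, LinearMap.sum_apply, ← Finset.sum_subset (Finset.subset_univ A)]
  · refine Finset.sum_congr rfl fun i hi => ?_
    have hiO := Finset.disjoint_left.mp hA hi
    have hi' := Finset.notMem_erase i A
    rw [Module.End.mul_apply]
    nth_rw 1 [← Finset.insert_erase hi]
    rw [pairVector_insert b O hi', annihilate_coord_create, if_pos rfl, annihilate_coord_create,
      if_neg (by simp), annihilate_inl_pairVector (disjoint_erase hA i) hi' hiO, map_zero,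
      sub_zero, map_zero, sub_zero, annihilate_coord_create, if_pos rfl,
      annihilate_inr_pairVector (disjoint_erase hA i) hi', map_zero, sub_zero]
  · intro i _ hi
    rw [Module.End.mul_apply, annihilate_anticomm, annihilate_inr_pairVector hA hi, map_zero,
      neg_zero]

lemma herm_pairVector_lefschetz (hA : Disjoint A O) (y : ExteriorAlgebra ℂ W) :
    herm b (pairVector b O A) (lefschetz b (dualLefschetz b y)) =
      ∑ i ∈ A, ∑ j ∈ Finset.univ.filter (fun j => j ∉ A.erase i ∧ j ∉ O),
        herm b (pairVector b O (insert j (A.erase i))) y := by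
  rw [← herm_dualLefschetz_left, dualLefschetz_pairVector hA, herm_sum_left]
  refine Finset.sum_congr rfl fun i _ => ?_
  rw [← herm_lefschetz_left, lefschetz_pairVector (disjoint_erase hA i), herm_sum_left]

/-- Each LΛ removes an index and inserts one, possibly the same, with coefficient 1, so N counts
d-step walks between `K` and `A`. A step changes |K \ A| by at most 1, and can lower it when
positive; no cancellation is possible. -/
lemma herm_pairVector_pow {K : Finset ι} (hK : Disjoint K O) (d : ℕ) :
    ∀ A : Finset ι, Disjoint A O → A.card = K.card →
      ∃ N : ℕ, herm b (pairVector b O A) (((lefschetz b * dualLefschetz b) ^ d)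
        (pairVector b O K)) = N ∧ (d < (K \ A).card → N = 0) ∧ ((K \ A).card = d → N ≠ 0) := by
  induction d with
  | zero =>
    intro A hA hcard
    refine ⟨if A = K then 1 else 0, ?_, ?_, ?_⟩
    · rw [pow_zero, Module.End.one_apply, herm_pairVector hA hK]
      split_ifs <;> simp
    · intro h
      rw [if_neg]
      rintro rfl
      simp at h
    · intro h
      rw [Finset.card_eq_zero, Finset.sdiff_eq_empty_iff_subset] at h
      rw [if_pos (Finset.eq_of_subset_of_card_le h hcard.le).symm]
      exact one_ne_zero
  | succ d ih =>
    intro A hA hcard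
    have hstep : ∀ i ∈ A, ∀ j, j ∉ A.erase i → j ∉ O →
        Disjoint (insert j (A.erase i)) O ∧ (insert j (A.erase i)).card = K.card := by
      intro i hi j hj hjO
      refine ⟨disjoint_insert (disjoint_erase hA i) hjO, ?_⟩
      rw [Finset.card_insert_of_notMem hj, Finset.card_erase_of_mem hi, ← hcard]
      have := Finset.card_pos.mpr ⟨i, hi⟩
      omega
    choose! N hN hN0 hN1 using ih
    refine ⟨∑ i ∈ A, ∑ j ∈ Finset.univ.filter (fun j => j ∉ A.erase i ∧ j ∉ O),
        N (insert j (A.erase i)), ?_, ?_, ?_⟩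
    · rw [pow_succ', Module.End.mul_apply, Module.End.mul_apply, herm_pairVector_lefschetz hA]
      push_cast
      refine Finset.sum_congr rfl fun i hi => Finset.sum_congr rfl fun j hj => ?_
      rw [Finset.mem_filter] at hj
      obtain ⟨h1, h2⟩ := hstep i hi j hj.2.1 hj.2.2
      exact hN _ h1 h2
    · intro hd
      refine Finset.sum_eq_zero fun i hi => Finset.sum_eq_zero fun j hj => ?_
      rw [Finset.mem_filter] at hj
      obtain ⟨h1, h2⟩ := hstep i hi j hj.2.1 hj.2.2
      refine hN0 _ h1 h2 ?_
      have hsub : K \ A ⊆ insert j (K \ insert j (A.erase i)) := by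
        intro t ht
        simp only [Finset.mem_sdiff, Finset.mem_insert, Finset.mem_erase] at ht ⊢
        tauto
      have := (Finset.card_le_card hsub).trans (Finset.card_insert_le _ _)
      omega
    · intro hd
      obtain ⟨j, hj⟩ : (K \ A).Nonempty := by rw [← Finset.card_pos]; omega
      obtain ⟨i, hi⟩ : (A \ K).Nonempty := by
        rw [← Finset.card_pos]
        have h1 := Finset.card_sdiff_add_card_inter A K
        have h2 := Finset.card_sdiff_add_card_inter K A
        rw [Finset.inter_comm] at h2
        omega
      rw [Finset.mem_sdiff] at hi hj
      have hjA : j ∉ A.erase i := fun h => hj.2 (Finset.mem_of_mem_erase h)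
      have hjO : j ∉ O := Finset.disjoint_left.mp hK hj.1
      obtain ⟨h1, h2⟩ := hstep i hi.1 j hjA hjO
      intro h0
      rw [Finset.sum_eq_zero_iff] at h0
      have h3 := (Finset.sum_eq_zero_iff.mp (h0 i hi.1)) j
        (Finset.mem_filter.mpr ⟨Finset.mem_univ j, hjA, hjO⟩)
      refine hN1 _ h1 h2 ?_ h3
      have : K \ insert j (A.erase i) = (K \ A).erase j := by
        ext t
        simp only [Finset.mem_sdiff, Finset.mem_insert, Finset.mem_erase]
        have : t ∈ K → t ≠ i := fun h h' => hi.2 (h' ▸ h)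
        tauto
      rw [this, Finset.card_erase_of_mem (Finset.mem_sdiff.mpr hj), hd]
      rfl

end PairVectors

lemma herm_rootOperator_inl_inr {W : Type*} [AddCommGroup W] [Module ℂ W] {ι : Type*} [Fintype ι]
    {b : Module.Basis (ι ⊕ ι) ℂ W} (i : ι) (u v : ExteriorAlgebra ℂ W) :
    herm b (rootOperator b (Sum.inl i) (Sum.inr i) u) v =
      herm b u (rootOperator b (Sum.inl i) (Sum.inr i) v) := by
  rw [herm_rootOperator_left, Sum.swap_inl, Sum.swap_inr, rootOperator_apply, rootOperator_apply,
    add_comm, basisSign_inl, basisSign_inr]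
  simp

/-! ### Linear equations satisfied by a paired vector and their solutions. -/

section PairInvariants

variable {W : Type*} [AddCommGroup W] [Module ℂ W] {ι : Type*} [DecidableEq ι]

/-- The elements of the exterior algebra that satisfy the same homogeneous linear equations as
`pairVector b O K` under the part of the symplectic Lie algebra that preserves the coordinate
splitting given by `K` and `O`. -/
noncomputable def pairInvariants (b : Module.Basis (ι ⊕ ι) ℂ W) (K O : Finset ι) :
    Submodule ℂ (ExteriorAlgebra ℂ W) where
  carrier := {z | z ∈ ⋀[ℂ]^(2 * K.card + O.card) W ∧
    (∀ i, rootOperator b (Sum.inl i) (Sum.inr i) z = (if i ∈ O then (-1 : ℂ) else 0) • z) ∧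
    ∀ i j, i ≠ j → i ∉ O → j ∉ O → (i ∈ K ↔ j ∈ K) →
      rootOperator b (Sum.inl i) (Sum.inr j) z = 0}
  add_mem' := by
    rintro u v ⟨h1, h2, h3⟩ ⟨h1', h2', h3'⟩
    refine ⟨Submodule.add_mem _ h1 h1', fun i => ?_, fun i j hij hi hj hK => ?_⟩
    · rw [map_add, smul_add, h2, h2']
    · rw [map_add, h3 i j hij hi hj hK, h3' i j hij hi hj hK, add_zero]
  zero_mem' := ⟨Submodule.zero_mem _, fun i => by rw [map_zero, smul_zero],
    fun i j _ _ _ _ => map_zero _⟩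
  smul_mem' := by
    rintro c u ⟨h1, h2, h3⟩
    refine ⟨Submodule.smul_mem _ c h1, fun i => ?_, fun i j hij hi hj hK => ?_⟩
    · rw [map_smul, h2, smul_comm]
    · rw [map_smul, h3 i j hij hi hj hK, smul_zero]

variable {b : Module.Basis (ι ⊕ ι) ℂ W} {K O : Finset ι}

lemma pairVector_mem_exteriorPower (hK : Disjoint K O) :
    pairVector b O K ∈ ⋀[ℂ]^(2 * K.card + O.card) W := by
  obtain ⟨ε, -, h⟩ := pairVector_eq b hK
  have h1 := wedgeBasis_mem b ((K ∪ O).disjSum K)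
  rw [Finset.card_disjSum, Finset.card_union_of_disjoint hK,
    show K.card + O.card + K.card = 2 * K.card + O.card by ring] at h1
  rw [h]
  exact Submodule.smul_mem _ _ h1

lemma pairVector_mem_pairInvariants (hK : Disjoint K O) :
    pairVector b O K ∈ pairInvariants b K O := by
  refine ⟨pairVector_mem_exteriorPower hK, fun i => ?_, fun i j hij hi hj hij' => ?_⟩
  · obtain ⟨ε, -, h⟩ := pairVector_eq b hK
    rw [h, map_smul, rootOperator_apply, Sum.swap_inl, Sum.swap_inr, number_wedgeBasis,
      number_wedgeBasis, smul_comm _ ε]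
    congr 1
    simp only [Finset.inl_mem_disjSum, Finset.inr_mem_disjSum, Finset.mem_union, basisSign_inl,
      basisSign_inr]
    have h0 : i ∈ K → i ∉ O := fun h => Finset.disjoint_left.mp hK h
    by_cases h1 : i ∈ K
    · simp [h1, h0 h1]
    · by_cases h2 : i ∈ O <;> simp [h1, h2]
  · obtain ⟨ε, -, h⟩ := pairVector_eq b hK
    rw [h, map_smul, rootOperator_apply, Sum.swap_inl, Sum.swap_inr]
    by_cases hiK : i ∈ K
    · rw [create_annihilate_wedgeBasis_of_mem_of_ne b (by simp [hiK]) (by simpa using hij),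
        create_annihilate_wedgeBasis_of_mem_of_ne b (by simp [hij'.mp hiK])
          (by simpa using hij.symm)]
      simp
    · have hjK : j ∉ K := fun h => hiK (hij'.mpr h)
      rw [create_annihilate_wedgeBasis_of_notMem b _ (by simp [hj, hjK]),
        create_annihilate_wedgeBasis_of_notMem b _ (by simp [hiK])]
      simp

/-- A difference of two paired vectors lies in the image of a root operator; a vector killed by the
adjoint operator thus has equal coefficients on both. -/
lemma rootOperator_create_create {A : Finset ι} (hA : Disjoint A O) {i j : ι}
    (hi : i ∉ A) (hiO : i ∉ O) (hj : j ∉ A) :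
    rootOperator b (Sum.inr i) (Sum.inl j)
        (create (b (Sum.inl i)) (create (b (Sum.inr j)) (pairVector b O A))) =
      pairVector b O (insert i A) - pairVector b O (insert j A) := by
  rw [rootOperator_apply, Sum.swap_inl, Sum.swap_inr, annihilate_coord_create,
    annihilate_coord_create, annihilate_coord_create, annihilate_coord_create, if_neg (by simp),
    if_pos rfl, if_pos rfl, if_neg (by simp), annihilate_inr_pairVector hA hj,
    annihilate_inl_pairVector hA hi hiO, pairVector_insert b O hi, pairVector_insert b O hj]
  simp only [map_zero, sub_zero, zero_sub, map_neg, basisSign_inl, basisSign_inr, one_smul,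
    neg_smul]
  rw [create_anticomm (b (Sum.inr i)), neg_neg, sub_eq_add_neg]

variable [Fintype ι]

lemma herm_exchange {z : ExteriorAlgebra ℂ W} (hz : z ∈ pairInvariants b K O) {A : Finset ι}
    (hA : Disjoint A O) {i j : ι} (hi : i ∈ A) (hj : j ∉ A) (hjO : j ∉ O)
    (hij : i ∈ K ↔ j ∈ K) :
    herm b (pairVector b O (insert j (A.erase i))) z = herm b (pairVector b O A) z := by
  have hne : i ≠ j := fun h => hj (h ▸ hi)
  have hiO := Finset.disjoint_left.mp hA hi
  have h1 := rootOperator_create_create (b := b) (disjoint_erase hA i)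
    (Finset.notMem_erase i A) hiO (fun h => hj (Finset.mem_of_mem_erase h))
  have h2 := herm_rootOperator_left (b := b) (Sum.inr i) (Sum.inl j)
    (create (b (Sum.inl i)) (create (b (Sum.inr j)) (pairVector b O (A.erase i)))) z
  rw [h1, Sum.swap_inr, Sum.swap_inl, hz.2.2 i j hne hiO hjO hij, smul_zero, map_zero,
    Finset.insert_erase hi, sub_eq_add_neg, herm_add_left,
    ← neg_one_smul ℂ (pairVector b O (insert j (A.erase i))), herm_smul_left, map_neg,
    map_one] at h2
  linear_combination -h2

lemma herm_eq_of_card_eq {z : ExteriorAlgebra ℂ W} (hz : z ∈ pairInvariants b K O)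
    {A A' : Finset ι} (hA : Disjoint A O) (hA' : Disjoint A' O) (hcard : A.card = A'.card)
    (hK : (A ∩ K).card = (A' ∩ K).card) :
    herm b (pairVector b O A') z = herm b (pairVector b O A) z := by
  refine exchange_induction (K := K) (O := O)
    (p := fun B => herm b (pairVector b O B) z = herm b (pairVector b O A) z)
    ?_ hA' _ A rfl hA hcard hK rfl
  intro B i j hB hi hj hjO hij h
  rw [herm_exchange hz hB hi hj hjO hij, h]

/-- The operators of the pairs eᵢ, fᵢ are diagonal on monomials, so a nonzero coefficient at I fixes
the weight of I. Hence I is the index set of a paired vector, and its degree fixes the number of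
pairs. -/
lemma repr_eq_zero_of_herm_eq_zero {z : ExteriorAlgebra ℂ W} (hz : z ∈ pairInvariants b K O)
    (h : ∀ A, Disjoint A O → A.card = K.card → herm b (pairVector b O A) z = 0)
    (I : Finset (ι ⊕ ι)) : (wedgeBasis b).repr z I = 0 := by
  by_contra h0
  have hI : ∀ i, -(if Sum.inl i ∈ I then (1 : ℂ) else 0) + (if Sum.inr i ∈ I then (1 : ℂ) else 0)
      = if i ∈ O then (-1 : ℂ) else 0 := by
    intro i
    have h1 := herm_rootOperator_inl_inr (b := b) i (wedgeBasis b I) z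
    rw [hz.2.1, map_smul, rootOperator_apply, Sum.swap_inl, Sum.swap_inr, number_wedgeBasis,
      number_wedgeBasis, smul_smul, smul_smul, ← add_smul, herm_smul_left,
      herm_wedgeBasis_left, smul_eq_mul] at h1
    have h2 := mul_right_cancel₀ h0 h1
    rw [← h2, basisSign_inl, basisSign_inr]
    split_ifs <;> simp
  have hI' : ∀ i, (Sum.inl i ∈ I ↔ i ∈ I.toRight ∨ i ∈ O) ∧ ¬ (i ∈ I.toRight ∧ i ∈ O) := by
    intro i
    have h1 := hI i
    rw [Finset.mem_toRight]
    by_cases ha : Sum.inl i ∈ I <;> by_cases hb : Sum.inr i ∈ I <;> by_cases hc : i ∈ O <;>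
      simp [ha, hb, hc] at h1 ⊢
    norm_num at h1
  have hd : Disjoint I.toRight O := Finset.disjoint_left.mpr fun i h1 h2 => (hI' i).2 ⟨h1, h2⟩
  have hL : I.toLeft = I.toRight ∪ O := by
    ext i
    rw [Finset.mem_toLeft, (hI' i).1, Finset.mem_union]
  have hII : (I.toRight ∪ O).disjSum I.toRight = I := by
    rw [← hL]
    exact Finset.toLeft_disjSum_toRight
  have hcard : I.card = 2 * K.card + O.card := by
    by_contra hne
    exact h0 (wedgeBasis_repr_eq_zero b hz.1 hne)
  have hcard' : I.toRight.card = K.card := by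
    rw [← hII, Finset.card_disjSum, Finset.card_union_of_disjoint hd] at hcard
    omega
  obtain ⟨ε, hε, h3⟩ := pairVector_eq b hd
  have h4 := h _ hd hcard'
  rw [h3, herm_smul_left, hII, herm_wedgeBasis_left] at h4
  rcases hε with rfl | rfl <;> simp [h0] at h4

lemma eq_zero_of_herm_eq_zero {z : ExteriorAlgebra ℂ W} (hz : z ∈ pairInvariants b K O)
    (h : ∀ A, Disjoint A O → A.card = K.card → herm b (pairVector b O A) z = 0) : z = 0 := by
  refine (wedgeBasis b).repr.map_eq_zero_iff.mp (Finsupp.ext fun I => ?_)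
  exact repr_eq_zero_of_herm_eq_zero hz h I

/-- Triangular elimination: coefficients of z depend only on |K \ A|. The d-th iterate vanishes
where |K \ A| > d and not where it equals d, so subtracting a multiple clears level d. -/
lemma mem_of_herm_eq_zero (hK : Disjoint K O) {M : Submodule ℂ (ExteriorAlgebra ℂ W)}
    (hpow : ∀ d, ((lefschetz b * dualLefschetz b) ^ d) (pairVector b O K) ∈
      pairInvariants b K O ⊓ M) (d : ℕ) :
    ∀ z ∈ pairInvariants b K O, (∀ A, Disjoint A O → A.card = K.card → d ≤ (K \ A).card →
      herm b (pairVector b O A) z = 0) → z ∈ M := by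
  induction d with
  | zero =>
    intro z hz h
    rw [eq_zero_of_herm_eq_zero hz fun A hA hcard => h A hA hcard (Nat.zero_le _)]
    exact Submodule.zero_mem M
  | succ d ih =>
    intro z hz h
    by_cases hex : ∃ A, Disjoint A O ∧ A.card = K.card ∧ (K \ A).card = d
    · obtain ⟨A₀, hA₀, hcard₀, hd₀⟩ := hex
      obtain ⟨N, hN, -, hN0⟩ := herm_pairVector_pow (b := b) hK d A₀ hA₀ hcard₀
      have hN' : (N : ℂ) ≠ 0 := Nat.cast_ne_zero.mpr (hN0 hd₀)
      set c : ℂ := herm b (pairVector b O A₀) z / N with hc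
      set y := ((lefschetz b * dualLefschetz b) ^ d) (pairVector b O K) with hy
      have hyI : y ∈ pairInvariants b K O := (hpow d).1
      have hyM : y ∈ M := (hpow d).2
      have h1 : z + (-c) • y ∈ M := by
        refine ih _ (Submodule.add_mem _ hz (Submodule.smul_mem _ _ hyI)) fun A hA hcard hd => ?_
        rw [map_add, map_smul, smul_eq_mul]
        rcases hd.lt_or_eq with hlt | heq
        · obtain ⟨N', hN', h0, -⟩ := herm_pairVector_pow (b := b) hK d A hA hcard
          rw [h A hA hcard hlt, hN', h0 hlt]
          simp
        · have hKA : (A₀ ∩ K).card = (A ∩ K).card := by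
            have e1 := Finset.card_sdiff_add_card_inter K A
            have e2 := Finset.card_sdiff_add_card_inter K A₀
            rw [Finset.inter_comm A₀, Finset.inter_comm A]
            omega
          rw [herm_eq_of_card_eq hz hA₀ hA (hcard₀.trans hcard.symm) hKA,
            herm_eq_of_card_eq hyI hA₀ hA (hcard₀.trans hcard.symm) hKA, hN, hc]
          field_simp
          ring
      have h2 := Submodule.add_mem M h1 (Submodule.smul_mem M c hyM)
      rwa [add_assoc, ← add_smul, neg_add_cancel, zero_smul, add_zero] at h2
    · refine ih z hz fun A hA hcard hd => ?_
      rcases hd.lt_or_eq with hlt | heq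
      · exact h A hA hcard hlt
      · exact absurd ⟨A, hA, hcard, heq.symm⟩ hex

/-- The pair invariants are spanned by the iterates of the Lefschetz operators on the paired
vector. -/
lemma pairInvariants_le (hK : Disjoint K O) {M : Submodule ℂ (ExteriorAlgebra ℂ W)}
    (hpow : ∀ d, ((lefschetz b * dualLefschetz b) ^ d) (pairVector b O K) ∈
      pairInvariants b K O ⊓ M) : pairInvariants b K O ≤ M := by
  intro z hz
  -- |K \ A| never exceeds |K|, so from this level on there is nothing to check.
  refine mem_of_herm_eq_zero hK hpow (K.card + 1) z hz fun A _ _ hd => ?_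
  have := Finset.card_le_card (Finset.sdiff_subset : K \ A ⊆ K)
  omega

end PairInvariants

/-! ### The commutant of the symplectic Lie algebra. -/

section Commutant

variable {W : Type*} [AddCommGroup W] [Module ℂ W] {Q : LinearMap.BilinForm ℂ W} {n : ℕ}
  {V : Type*} [AddCommGroup V] [Module ℂ V] (e : V ≃ₗ[ℂ] ⋀[ℂ]^n W)
  {ι : Type*} [DecidableEq ι] {b : Module.Basis (ι ⊕ ι) ℂ W}

lemma exists_pair_finsets (ι : Type*) [Fintype ι] [DecidableEq ι] {n : ℕ}
    (hn : n ≤ 2 * Fintype.card ι) :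
    ∃ K O : Finset ι, Disjoint K O ∧ O.card ≤ 1 ∧ n = 2 * K.card + O.card := by
  obtain ⟨K, -, hK⟩ := Finset.exists_subset_card_eq (s := (Finset.univ : Finset ι)) (n := n / 2)
    (by rw [Finset.card_univ]; omega)
  obtain ⟨O, hO, hO'⟩ := Finset.exists_subset_card_eq (s := Kᶜ) (n := n % 2)
    (by rw [Finset.card_compl]; omega)
  exact ⟨K, O, disjoint_compl_right.mono_right hO, by omega, by omega⟩

/-- An endomorphism that commutes with the symplectic Lie algebra preserves the linear equations
satisfied by a paired vector. -/
lemma toAlgebra_mem_pairInvariants (hb : IsSymplecticFamily Q b) {K O : Finset ι}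
    (hK : Disjoint K O) (e : V ≃ₗ[ℂ] ⋀[ℂ]^(2 * K.card + O.card) W) {w : V}
    (hw : toAlgebra e w = pairVector b O K) {T : Module.End ℂ V}
    (hT : ∀ Y ∈ symplecticDerivations Q e, T * Y = Y * T) :
    toAlgebra e (T w) ∈ pairInvariants b K O := by
  have h := pairVector_mem_pairInvariants (b := b) hK
  have key : ∀ x y, rootOperator b x y (toAlgebra e (T w)) =
      toAlgebra e (T (symDerivation Q e (b x) (b y) w)) := by
    intro x y
    rw [← hb.toAlgebra_symDerivation e, ← Module.End.mul_apply, ← Module.End.mul_apply,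
      hT _ (symDerivation_mem Q e _ _)]
  refine ⟨toAlgebra_mem e _, fun i => ?_, fun i j hij hi hj hij' => ?_⟩
  · have h1 : symDerivation Q e (b (Sum.inl i)) (b (Sum.inr i)) w =
        (if i ∈ O then (-1 : ℂ) else 0) • w := by
      apply toAlgebra_injective e
      rw [hb.toAlgebra_symDerivation e, map_smul, hw, h.2.1]
    rw [key, h1, map_smul, map_smul]
  · have h1 : symDerivation Q e (b (Sum.inl i)) (b (Sum.inr j)) w = 0 := by
      apply toAlgebra_injective e
      rw [hb.toAlgebra_symDerivation e, map_zero, hw, h.2.2 i j hij hi hj hij']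
    rw [key, h1, map_zero, map_zero]

/-- An endomorphism commuting with the symplectic Lie algebra is determined by its value on a
paired vector. -/
lemma eq_of_apply_pairVector_eq (hb : IsSymplecticFamily Q b) {K O : Finset ι}
    (hK : Disjoint K O) (hO : O.card ≤ 1) (e : V ≃ₗ[ℂ] ⋀[ℂ]^(2 * K.card + O.card) W) {w : V}
    (hw : toAlgebra e w = pairVector b O K) {T S : Module.End ℂ V}
    (hT : ∀ Y ∈ symplecticDerivations Q e, T * Y = Y * T)
    (hS : ∀ Y ∈ symplecticDerivations Q e, S * Y = Y * S) (h : T w = S w) : T = S := by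
  -- The locus where T and S agree is stable under 𝔤 and contains the generating vector w.
  set Y : Submodule ℂ (ExteriorAlgebra ℂ W) := (LinearMap.eqLocus T S).map (toAlgebra e) with hY
  have hroot : ∀ x y, ∀ u ∈ Y, rootOperator b x y u ∈ Y := by
    rintro x y _ ⟨z, hz, rfl⟩
    rw [SetLike.mem_coe, LinearMap.mem_eqLocus] at hz
    refine ⟨symDerivation Q e (b x) (b y) z, ?_, hb.toAlgebra_symDerivation e x y z⟩
    rw [SetLike.mem_coe, LinearMap.mem_eqLocus, ← Module.End.mul_apply, ← Module.End.mul_apply,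
      hT _ (symDerivation_mem Q e _ _), hS _ (symDerivation_mem Q e _ _), Module.End.mul_apply,
      Module.End.mul_apply, hz]
  have hmem : wedgeBasis b ((K ∪ O).disjSum K) ∈ Y := by
    obtain ⟨ε, hε, h1⟩ := pairVector_eq b hK
    refine mem_of_smul_mem_of_ne_zero Y (c := ε) (by rcases hε with rfl | rfl <;> simp) ?_
    rw [← h1]
    exact ⟨w, h, hw⟩
  have hle : ⋀[ℂ]^(2 * K.card + O.card) W ≤ Y := by
    refine (exteriorPower_le_span b _).trans (Submodule.span_le.mpr ?_)
    rintro _ ⟨I, hI, rfl⟩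
    exact wedgeBasis_mem_of_card hroot hK hO hmem _ I rfl hI
  ext z
  obtain ⟨z', hz', h1⟩ := hle (toAlgebra_mem e z)
  rw [toAlgebra_injective e h1] at hz'
  exact hz'

/-- The commutant of the symplectic Lie algebra on `⋀ⁿ W` is generated by the Casimir operator. -/
lemma exists_aeval_casimir_eq [Fintype ι] (hb : IsSymplecticFamily Q b)
    (hn : n ≤ 2 * Fintype.card ι)
    (hcas : ∀ Y ∈ symplecticDerivations Q e, casimir Q e b * Y = Y * casimir Q e b)
    {T : Module.End ℂ V} (hT : ∀ Y ∈ symplecticDerivations Q e, T * Y = Y * T) :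
    ∃ p : Polynomial ℂ, T = Polynomial.aeval (casimir Q e b) p := by
  obtain ⟨K, O, hK, hO, rfl⟩ := exists_pair_finsets ι hn
  obtain ⟨w, hw⟩ := exists_toAlgebra_eq e (pairVector_mem_exteriorPower (b := b) hK)
  have hcomm : ∀ p : Polynomial ℂ, ∀ Y ∈ symplecticDerivations Q e,
      Polynomial.aeval (casimir Q e b) p * Y = Y * Polynomial.aeval (casimir Q e b) p := by
    intro p Y hY
    induction p using Polynomial.induction_on' with
    | add p q hp hq => rw [map_add, add_mul, mul_add, hp, hq]
    | monomial k a =>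
      rw [Polynomial.aeval_monomial, mul_assoc, (Commute.pow_left (hcas Y hY) k).eq,
        ← mul_assoc, ← mul_assoc, Algebra.commutes]
  set M : Submodule ℂ (ExteriorAlgebra ℂ W) := LinearMap.range
    (toAlgebra e ∘ₗ LinearMap.applyₗ w ∘ₗ (Polynomial.aeval (casimir Q e b)).toLinearMap) with hM
  obtain ⟨α, hα⟩ : ∃ α : ℂ, ∀ z, toAlgebra e (casimir Q e b z) =
      (8 : ℂ) • lefschetz b (dualLefschetz b (toAlgebra e z)) + α • toAlgebra e z :=
    ⟨_, toAlgebra_casimir hb e⟩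
  -- On V, LΛ is (C − α)/8, so its iterates at w are values of polynomials in C.
  have hpow : ∀ d, ((lefschetz b * dualLefschetz b) ^ d) (pairVector b O K) =
      toAlgebra e (Polynomial.aeval (casimir Q e b)
        ((Polynomial.C (8⁻¹ : ℂ) * (Polynomial.X - Polynomial.C α)) ^ d) w) := by
    intro d
    induction d with
    | zero => simp [hw]
    | succ d ih =>
      rw [pow_succ', pow_succ', Module.End.mul_apply, ih, map_mul (Polynomial.aeval _),
        Module.End.mul_apply, Module.End.mul_apply]
      set z := Polynomial.aeval (casimir Q e b)
        ((Polynomial.C (8⁻¹ : ℂ) * (Polynomial.X - Polynomial.C α)) ^ d) w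
      have h1 : Polynomial.aeval (casimir Q e b)
          (Polynomial.C (8⁻¹ : ℂ) * (Polynomial.X - Polynomial.C α)) z =
          (8⁻¹ : ℂ) • (casimir Q e b z - α • z) := by
        rw [map_mul, map_sub, Polynomial.aeval_C, Polynomial.aeval_X, Polynomial.aeval_C,
          Module.End.mul_apply, LinearMap.sub_apply, Module.algebraMap_end_apply,
          Module.algebraMap_end_apply]
      rw [h1, map_smul, map_sub, hα, map_smul, add_sub_cancel_right, smul_smul]
      norm_num
  have hle : pairInvariants b K O ≤ M := by
    refine pairInvariants_le hK fun d => ?_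
    rw [hpow d]
    exact ⟨toAlgebra_mem_pairInvariants hb hK e hw (hcomm _), ⟨_, rfl⟩⟩
  obtain ⟨p, hp⟩ := hle (toAlgebra_mem_pairInvariants hb hK e hw hT)
  exact ⟨p, eq_of_apply_pairVector_eq hb hK hO e hw hT (hcomm p) (toAlgebra_injective e hp).symm⟩

end Commutant

/-! ### Adjoints in a Euclidean model of the exterior power. -/

section Adjoint

variable {W : Type*} [AddCommGroup W] [Module ℂ W] {Q : LinearMap.BilinForm ℂ W} {n : ℕ}
  {V : Type*} [NormedAddCommGroup V] [InnerProductSpace ℂ V] [FiniteDimensional ℂ V]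
  {e : V ≃ₗ[ℂ] ⋀[ℂ]^n W}
  {ι : Type*} [Fintype ι] {b : Module.Basis (ι ⊕ ι) ℂ W}

/-- The trace is the sum of the squared norms of the adjoint on an orthonormal basis. -/
lemma eq_zero_of_trace_mul_adjoint {T : Module.End ℂ V}
    (h : LinearMap.trace ℂ V (T * LinearMap.adjoint T) = 0) : T = 0 := by
  have h1 : ∀ i, LinearMap.adjoint T (stdOrthonormalBasis ℂ V i) = 0 := by
    rw [LinearMap.trace_eq_sum_inner _ (stdOrthonormalBasis ℂ V)] at h
    have h2 : ∑ i, ‖LinearMap.adjoint T (stdOrthonormalBasis ℂ V i)‖ ^ 2 = 0 := by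
      have h3 : ((∑ i, ‖LinearMap.adjoint T (stdOrthonormalBasis ℂ V i)‖ ^ 2 : ℝ) : ℂ) = 0 := by
        rw [← h]
        push_cast
        refine Finset.sum_congr rfl fun i _ => ?_
        rw [Module.End.mul_apply, ← LinearMap.adjoint_inner_left, inner_self_eq_norm_sq_to_K]
        rfl
      exact_mod_cast h3
    intro i
    rw [Finset.sum_eq_zero_iff_of_nonneg fun i _ => sq_nonneg _] at h2
    exact norm_eq_zero.mp (pow_eq_zero_iff two_ne_zero |>.mp (h2 i (Finset.mem_univ i)))
  have h4 : LinearMap.adjoint T = 0 :=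
    (stdOrthonormalBasis ℂ V).toBasis.ext fun i => by
      rw [OrthonormalBasis.coe_toBasis, h1, LinearMap.zero_apply]
  rw [← LinearMap.adjoint_adjoint T, h4, map_zero]

/-- An endomorphism that preserves a subspace together with its adjoint commutes with the
orthogonal projection. -/
lemma starProjection_comm {U : Submodule ℂ V} {T : Module.End ℂ V} (h1 : ∀ u ∈ U, T u ∈ U)
    (h2 : ∀ u ∈ U, LinearMap.adjoint T u ∈ U) :
    (U.starProjection : V →ₗ[ℂ] V) * T = T * (U.starProjection : V →ₗ[ℂ] V) := by
  ext z
  rw [Module.End.mul_apply, Module.End.mul_apply, ContinuousLinearMap.coe_coe]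
  refine Submodule.eq_starProjection_of_mem_of_inner_eq_zero
    (h1 _ (Submodule.starProjection_apply_mem U z)) fun u hu => ?_
  rw [← map_sub, ← LinearMap.adjoint_inner_right]
  exact Submodule.starProjection_inner_eq_zero z _ (h2 u hu)

variable [DecidableEq ι]

lemma adjoint_symDerivation (hb : IsSymplecticFamily Q b)
    (he : ∀ u v : V, inner ℂ u v = herm b (toAlgebra e u) (toAlgebra e v)) (x y : ι ⊕ ι) :
    LinearMap.adjoint (symDerivation Q e (b x) (b y)) =
      -(basisSign x * basisSign y) • symDerivation Q e (b x.swap) (b y.swap) := by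
  have h : symDerivation Q e (b x) (b y) = LinearMap.adjoint
      (-(basisSign x * basisSign y) • symDerivation Q e (b x.swap) (b y.swap)) := by
    rw [LinearMap.eq_adjoint_iff]
    intro u v
    rw [he, he, hb.toAlgebra_symDerivation, herm_rootOperator_left, LinearMap.smul_apply,
      map_smul (toAlgebra e), hb.toAlgebra_symDerivation]
  rw [h, LinearMap.adjoint_adjoint]

lemma adjoint_mem (hb : IsSymplecticFamily Q b)
    (he : ∀ u v : V, inner ℂ u v = herm b (toAlgebra e u) (toAlgebra e v))
    {Y : Module.End ℂ V} (hY : Y ∈ symplecticDerivations Q e) :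
    LinearMap.adjoint Y ∈ symplecticDerivations Q e := by
  refine Submodule.span_induction
    (p := fun Y _ => LinearMap.adjoint Y ∈ symplecticDerivations Q e) ?_ ?_ ?_ ?_ hY
  · rintro _ ⟨v, rfl⟩
    have h := congrArg LinearMap.adjoint (sum_coord_symDerivation (b := b) (Q := Q) e v)
    have h2 : LinearMap.adjoint ((2 : ℂ) • transvectionDerivation Q e v) ∈
        symplecticDerivations Q e := by
      rw [← h, map_sum]
      refine Submodule.sum_mem _ fun p _ => ?_
      rw [map_smulₛₗ, adjoint_symDerivation hb he]
      exact Submodule.smul_mem _ _ (Submodule.smul_mem _ _ (symDerivation_mem Q e _ _))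
    rw [map_smulₛₗ] at h2
    exact mem_of_smul_mem_of_ne_zero _ (by simp) h2
  · rw [map_zero]; exact zero_mem _
  · intro S T _ _ hS hT
    rw [map_add]; exact add_mem hS hT
  · intro r S _ hS
    rw [map_smulₛₗ]; exact Submodule.smul_mem _ _ hS

/-- The exterior power of a space with a symplectic basis is isomorphic to a Euclidean space in
which the monomials are orthonormal. -/
lemma exists_euclidean_equiv (b : Module.Basis (ι ⊕ ι) ℂ W) (n : ℕ) :
    ∃ e : EuclideanSpace ℂ {I : Finset (ι ⊕ ι) // I.card = n} ≃ₗ[ℂ] ⋀[ℂ]^n W,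
      ∀ u v, inner ℂ u v = herm b (toAlgebra e u) (toAlgebra e v) := by
  let B : {I : Finset (ι ⊕ ι) // I.card = n} → ⋀[ℂ]^n W :=
    fun I => ⟨wedgeBasis b I.1, by simpa only [I.2] using wedgeBasis_mem b I.1⟩
  have hli : LinearIndependent ℂ B := by
    refine LinearIndependent.of_comp (⋀[ℂ]^n W).subtype ?_
    exact (wedgeBasis b).linearIndependent.comp Subtype.val Subtype.val_injective
  have hspan : ⊤ ≤ Submodule.span ℂ (Set.range B) := by
    rintro ⟨z, hz⟩ -
    have h := exteriorPower_le_span b n hz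
    have h1 : wedgeBasis b '' {I | I.card = n} = (⋀[ℂ]^n W).subtype '' Set.range B := by
      ext t
      constructor
      · rintro ⟨I, hI, rfl⟩
        exact ⟨B ⟨I, hI⟩, ⟨_, rfl⟩, rfl⟩
      · rintro ⟨_, ⟨I, rfl⟩, rfl⟩
        exact ⟨I.1, I.2, rfl⟩
    rw [h1, Submodule.span_image] at h
    obtain ⟨y, hy, hyz⟩ := h
    rwa [show (⟨z, hz⟩ : ⋀[ℂ]^n W) = y from Subtype.ext hyz.symm]
  let e : EuclideanSpace ℂ {I : Finset (ι ⊕ ι) // I.card = n} ≃ₗ[ℂ] ⋀[ℂ]^n W :=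
    (WithLp.linearEquiv 2 ℂ _).trans (Module.Basis.mk hli hspan).equivFun.symm
  have he : ∀ u, toAlgebra e u = ∑ I, u I • wedgeBasis b I.1 := by
    intro u
    change (((Module.Basis.mk hli hspan).equivFun.symm (WithLp.linearEquiv 2 ℂ _ u) : ⋀[ℂ]^n W) :
      ExteriorAlgebra ℂ W) = _
    rw [Module.Basis.equivFun_symm_apply, Module.Basis.coe_mk, AddSubmonoidClass.coe_finsetSum]
    rfl
  refine ⟨e, fun u v => ?_⟩
  rw [he, he, herm_sum_left, PiLp.inner_apply]
  refine Finset.sum_congr rfl fun I _ => ?_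
  simp only [map_sum, herm_smul_left, map_smul, herm_wedgeBasis, smul_eq_mul]
  rw [Finset.sum_eq_single I]
  · simp [mul_comm]
  · intro J _ hJ
    rw [if_neg (fun h => hJ (Subtype.ext h.symm)), mul_zero, mul_zero]
  · simp

end Adjoint

/-! ### Normalizing automorphisms and invariant subspaces. -/

section Normalizer

variable {W : Type*} [AddCommGroup W] [Module ℂ W] {Q : LinearMap.BilinForm ℂ W} {n : ℕ}

lemma symplecticDerivations_apply_mem {V : Type*} [AddCommGroup V] [Module ℂ V]
    (e : V ≃ₗ[ℂ] ⋀[ℂ]^n W) (hQalt : Q.IsAlt) {U : Submodule ℂ V}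
    (hU : ∀ h ∈ symplecticSubgroup Q, ∀ u ∈ U, powerAction e h u ∈ U) {Y : Module.End ℂ V}
    (hY : Y ∈ symplecticDerivations Q e) {u : V} (hu : u ∈ U) : Y u ∈ U := by
  refine Submodule.span_induction (p := fun Y _ => Y u ∈ U) ?_ ?_ ?_ ?_ hY
  · rintro _ ⟨v, rfl⟩
    have h := hU _ (transvection_mem hQalt v 1) u hu
    rw [powerAction_transvection] at h
    exact (Submodule.add_mem_iff_right U hu).mp h
  · exact zero_mem _
  · intro S T _ _ hS hT
    exact add_mem hS hT
  · intro r S _ hS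
    exact Submodule.smul_mem _ _ hS

variable {V : Type*} [NormedAddCommGroup V] [InnerProductSpace ℂ V] [FiniteDimensional ℂ V]
  {e : V ≃ₗ[ℂ] ⋀[ℂ]^n W} {ι : Type*} [Fintype ι] [DecidableEq ι]
  {b : Module.Basis (ι ⊕ ι) ℂ W}

/-- The adjoint of Y is again in 𝔤, so a vanishing trace form makes the Hilbert–Schmidt norm of Y
zero. This settles the degenerate case κ = 0. -/
lemma eq_zero_of_trace_form_eq_zero (hb : IsSymplecticFamily Q b)
    (he : ∀ u v : V, inner ℂ u v = herm b (toAlgebra e u) (toAlgebra e v))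
    (hκ : ∀ v w, LinearMap.trace ℂ V
      (transvectionDerivation Q e v * transvectionDerivation Q e w) = 0 * Q v w ^ 2)
    {Y : Module.End ℂ V} (hY : Y ∈ symplecticDerivations Q e) : Y = 0 :=
  eq_zero_of_trace_mul_adjoint (trace_mul_eq_zero e hκ rfl hY (adjoint_mem hb he hY))

/-- Conjugation by a transvection fixes C, and commuting with 1 + D_v is commuting with D_v. -/
lemma casimir_mul_comm (hb : IsSymplecticFamily Q b) (hQalt : Q.IsAlt)
    (he : ∀ u v : V, inner ℂ u v = herm b (toAlgebra e u) (toAlgebra e v)) {κ : ℂ}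
    (hκ : ∀ v w, LinearMap.trace ℂ V
      (transvectionDerivation Q e v * transvectionDerivation Q e w) = κ * Q v w ^ 2)
    {Y : Module.End ℂ V} (hY : Y ∈ symplecticDerivations Q e) :
    casimir Q e b * Y = Y * casimir Q e b := by
  by_cases h0 : κ = 0
  · subst h0
    rw [eq_zero_of_trace_form_eq_zero hb he hκ hY, mul_zero, zero_mul]
  refine Submodule.span_induction (p := fun Y _ => casimir Q e b * Y = Y * casimir Q e b)
    ?_ ?_ ?_ ?_ hY
  · rintro _ ⟨v, rfl⟩
    have hmem := transvection_mem hQalt v 1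
    have h := casimir_conj e hb hκ h0 (powerAction e (transvection hQalt v 1))
      (fun Y hY => conj_powerAction_mem e hmem hY)
      (fun Y hY => by
        rw [powerAction_symm]
        exact conj_powerAction_mem e (inv_mem hmem) hY)
    ext z
    have h1 := LinearMap.congr_fun h (powerAction e (transvection hQalt v 1) z)
    rw [LinearEquiv.conjAlgEquiv_apply, LinearMap.comp_apply, LinearMap.comp_apply,
      LinearEquiv.coe_coe, LinearEquiv.coe_coe, LinearEquiv.symm_apply_apply,
      powerAction_transvection, powerAction_transvection, map_add] at h1
    exact (add_left_cancel h1).symm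
  · simp
  · intro S T _ _ hS hT
    rw [mul_add, add_mul, hS, hT]
  · intro r S _ hS
    rw [mul_smul_comm, smul_mul_assoc, hS]

/-- An automorphism that conjugates the image of the symplectic group into itself conjugates the
image of the symplectic Lie algebra into itself. -/
lemma conj_mem_symplecticDerivations (hb : IsSymplecticFamily Q b) (hQalt : Q.IsAlt)
    (hn : n ≤ 2 * Fintype.card ι)
    (he : ∀ u v : V, inner ℂ u v = herm b (toAlgebra e u) (toAlgebra e v)) {κ : ℂ}
    (hκ : ∀ v w, LinearMap.trace ℂ V
      (transvectionDerivation Q e v * transvectionDerivation Q e w) = κ * Q v w ^ 2)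
    (h0 : κ ≠ 0) {g : V ≃ₗ[ℂ] V} (hg : ∀ f ∈ symplecticSubgroup Q,
      ∃ f' ∈ symplecticSubgroup Q, ∀ z, g (powerAction e f (g.symm z)) = powerAction e f' z)
    {Y : Module.End ℂ V} (hY : Y ∈ symplecticDerivations Q e) :
    g.conjAlgEquiv ℂ Y ∈ symplecticDerivations Q e := by
  have hcas := fun Y hY => casimir_mul_comm hb hQalt he hκ (Y := Y) hY
  refine Submodule.span_induction
    (p := fun Y _ => g.conjAlgEquiv ℂ Y ∈ symplecticDerivations Q e) ?_ ?_ ?_ ?_ hY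
  · rintro _ ⟨v, rfl⟩
    have hsq : g.conjAlgEquiv ℂ (transvectionDerivation Q e v) *
        g.conjAlgEquiv ℂ (transvectionDerivation Q e v) = 0 := by
      rw [← map_mul, transvectionDerivation_mul_self e hQalt, map_zero]
    -- Conjugating 1 + D_v by g gives 1 + X with X square-zero, and this is the action of the
    -- symplectic map f.
    obtain ⟨f, hf, hfg⟩ := hg _ (transvection_mem hQalt v 1)
    refine mem_of_sq_eq_zero_of_normalizes
      (fun p : (ι ⊕ ι) × (ι ⊕ ι) => symDerivation_mem Q e (b p.1) (b p.2))
      (mul_ne_zero (by norm_num) h0 : (4 * κ : ℂ) ≠ 0) (reproducing_right e hb hκ)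
      rfl ?_ (fun Y hY Y' hY' => bracket_mem e hQalt hY hY') LinearMap.adjoint
      LinearMap.adjoint_adjoint (fun S T => LinearMap.adjoint_comp S T)
      (fun T hT => eq_zero_of_trace_mul_adjoint hT) (fun Y hY => adjoint_mem hb he hY) ?_ hsq
      (fun Y hY => bracket_mem_of_powerAction e hf hsq ?_ hY)
    · rintro _ ⟨w, rfl⟩
      exact transvectionDerivation_mul_self e hQalt w
    · intro T T' hT hT'
      obtain ⟨p, rfl⟩ := exists_aeval_casimir_eq e hb hn hcas hT
      obtain ⟨q, rfl⟩ := exists_aeval_casimir_eq e hb hn hcas hT'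
      rw [← map_mul, mul_comm, map_mul]
    · intro z
      rw [← hfg, powerAction_transvection, map_add, LinearEquiv.apply_symm_apply]
      rfl
  · rw [map_zero]; exact zero_mem _
  · intro S T _ _ hS hT
    rw [map_add]; exact add_mem hS hT
  · intro r S _ hS
    rw [map_smul]; exact Submodule.smul_mem _ _ hS

lemma conj_casimir (hb : IsSymplecticFamily Q b) (hQalt : Q.IsAlt)
    (hn : n ≤ 2 * Fintype.card ι)
    (he : ∀ u v : V, inner ℂ u v = herm b (toAlgebra e u) (toAlgebra e v)) {κ : ℂ}
    (hκ : ∀ v w, LinearMap.trace ℂ V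
      (transvectionDerivation Q e v * transvectionDerivation Q e w) = κ * Q v w ^ 2)
    {g : V ≃ₗ[ℂ] V} (hg : ∀ f ∈ symplecticSubgroup Q,
      ∃ f' ∈ symplecticSubgroup Q, ∀ z, g (powerAction e f (g.symm z)) = powerAction e f' z)
    (hg' : ∀ f ∈ symplecticSubgroup Q,
      ∃ f' ∈ symplecticSubgroup Q, ∀ z, g.symm (powerAction e f (g z)) = powerAction e f' z) :
    g.conjAlgEquiv ℂ (casimir Q e b) = casimir Q e b := by
  by_cases h0 : κ = 0
  · subst h0
    have h1 : casimir Q e b = 0 := Finset.sum_eq_zero fun p _ => by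
      rw [eq_zero_of_trace_form_eq_zero hb he hκ (symDerivation_mem Q e (b p.1) (b p.2)),
        zero_mul]
    rw [h1, map_zero]
  · exact casimir_conj e hb hκ h0 g
      (fun Y hY => conj_mem_symplecticDerivations hb hQalt hn he hκ h0 hg hY)
      (fun Y hY => conj_mem_symplecticDerivations (g := g.symm) hb hQalt hn he hκ h0 hg' hY)

/-- An automorphism normalizing the image of the symplectic group maps invariant subspaces into
themselves. -/
lemma apply_mem_of_normalizes (hb : IsSymplecticFamily Q b) (hQ : Q.Nondegenerate)
    (hQalt : Q.IsAlt) (hn : n ≤ 2 * Fintype.card ι)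
    (he : ∀ u v : V, inner ℂ u v = herm b (toAlgebra e u) (toAlgebra e v))
    {g : V ≃ₗ[ℂ] V} (hg : ∀ f ∈ symplecticSubgroup Q,
      ∃ f' ∈ symplecticSubgroup Q, ∀ z, g (powerAction e f (g.symm z)) = powerAction e f' z)
    (hg' : ∀ f ∈ symplecticSubgroup Q,
      ∃ f' ∈ symplecticSubgroup Q, ∀ z, g.symm (powerAction e f (g z)) = powerAction e f' z)
    {U : Submodule ℂ V} (hU : ∀ h ∈ symplecticSubgroup Q, ∀ u ∈ U, powerAction e h u ∈ U)
    {u : V} (hu : u ∈ U) : g u ∈ U := by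
  obtain ⟨κ, hκ⟩ := exists_trace_eq (V := V) e hQ hQalt
  obtain ⟨p, hp⟩ := exists_aeval_casimir_eq e hb hn
    (fun Y hY => casimir_mul_comm hb hQalt he hκ hY) (T := (U.starProjection : V →ₗ[ℂ] V))
    (fun Y hY => starProjection_comm
      (fun u hu => symplecticDerivations_apply_mem e hQalt hU hY hu)
      (fun u hu => symplecticDerivations_apply_mem e hQalt hU (adjoint_mem hb he hY) hu))
  -- Conjugation by g fixes C, hence every polynomial in C, among them the projection onto U.
  have h1 : g.conjAlgEquiv ℂ (U.starProjection : V →ₗ[ℂ] V) = (U.starProjection : V →ₗ[ℂ] V) := by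
    rw [hp, ← Polynomial.aeval_algHom_apply, conj_casimir hb hQalt hn he hκ hg hg']
  have h2 := LinearMap.congr_fun h1 (g u)
  rw [LinearEquiv.conjAlgEquiv_apply, LinearMap.comp_apply, LinearMap.comp_apply,
    LinearEquiv.coe_coe, LinearEquiv.coe_coe, LinearEquiv.symm_apply_apply,
    ContinuousLinearMap.coe_coe, Submodule.starProjection_eq_self_iff.mpr hu] at h2
  rw [h2]
  exact Submodule.starProjection_apply_mem U _

end Normalizer

/-! ### Transfer from the Euclidean model to ⋀ⁿ W. -/

section Main

variable {W : Type*} [AddCommGroup W] [Module ℂ W]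

lemma exteriorPower_apply_mem_of_normalizes [FiniteDimensional ℂ W]
    (Q : LinearMap.BilinForm ℂ W) (hQ : Q.Nondegenerate) (hQalt : Q.IsAlt)
    (n : ℕ) (hn : n ≤ Module.finrank ℂ W) (g : ⋀[ℂ]^n W ≃ₗ[ℂ] ⋀[ℂ]^n W)
    (hg : ∀ f ∈ symplecticSubgroup Q, ∃ f' ∈ symplecticSubgroup Q,
      ∀ z, g (exteriorPowerRep W n f (g.symm z)) = exteriorPowerRep W n f' z)
    (hg' : ∀ f ∈ symplecticSubgroup Q, ∃ f' ∈ symplecticSubgroup Q,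
      ∀ z, g.symm (exteriorPowerRep W n f (g z)) = exteriorPowerRep W n f' z)
    (U : Submodule ℂ (⋀[ℂ]^n W))
    (hU : ∀ h ∈ symplecticSubgroup Q, ∀ u ∈ U, exteriorPowerRep W n h u ∈ U)
    {u : ⋀[ℂ]^n W} (hu : u ∈ U) : g u ∈ U := by
  obtain ⟨m, b, hb⟩ := exists_symplecticBasis hQ hQalt
  obtain ⟨e, he⟩ := exists_euclidean_equiv b n
  rw [Module.finrank_eq_card_basis b, Fintype.card_sum, ← two_mul] at hn
  have h := apply_mem_of_normalizes hb hQ hQalt hn he (g := (e.trans g).trans e.symm)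
    (U := U.comap e.toLinearMap) (u := e.symm u) ?_ ?_ ?_ ?_
  · simpa using h
  · intro f hf
    obtain ⟨f', hf', h⟩ := hg f hf
    refine ⟨f', hf', fun z => ?_⟩
    simp [powerAction, h]
  · intro f hf
    obtain ⟨f', hf', h⟩ := hg' f hf
    refine ⟨f', hf', fun z => ?_⟩
    simp [powerAction, h]
  · intro f hf z hz
    simpa [powerAction] using hU f hf _ hz
  · simpa using hu

lemma conj_exteriorPowerRep {Q : LinearMap.BilinForm ℂ W} {n : ℕ}
    {g : ⋀[ℂ]^n W ≃ₗ[ℂ] ⋀[ℂ]^n W} (hg : g ∈ Subgroup.normalizer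
      ((symplecticSubgroup Q).map (exteriorPowerRep W n) : Set (⋀[ℂ]^n W ≃ₗ[ℂ] ⋀[ℂ]^n W)))
    (f : W ≃ₗ[ℂ] W) (hf : f ∈ symplecticSubgroup Q) : ∃ f' ∈ symplecticSubgroup Q,
      ∀ z, g (exteriorPowerRep W n f (g.symm z)) = exteriorPowerRep W n f' z := by
  obtain ⟨f', hf', h⟩ := (Subgroup.mem_normalizer_iff.mp hg _).mp ⟨f, hf, rfl⟩
  exact ⟨f', hf', fun z => (LinearEquiv.congr_fun h z).symm⟩

end Main

end SymplecticExterior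

theorem mainTheorem11 {W : Type*} [AddCommGroup W] [Module ℂ W] [FiniteDimensional ℂ W]
    (Q : LinearMap.BilinForm ℂ W) (hQ : Q.Nondegenerate) (hQalt : Q.IsAlt)
    (n : ℕ) (hn : n + 1 ≤ Module.finrank ℂ W)
    (g : ⋀[ℂ]^n W ≃ₗ[ℂ] ⋀[ℂ]^n W)
    (hg : g ∈ Subgroup.normalizer
      ((symplecticSubgroup Q).map (exteriorPowerRep W n) : Set (⋀[ℂ]^n W ≃ₗ[ℂ] ⋀[ℂ]^n W)))
    (U : Submodule ℂ (⋀[ℂ]^n W))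
    (hU : ∀ h ∈ symplecticSubgroup Q, ∀ u ∈ U, exteriorPowerRep W n h u ∈ U) :
    U.map (g : ⋀[ℂ]^n W →ₗ[ℂ] ⋀[ℂ]^n W) = U := by
  have h1 := SymplecticExterior.conj_exteriorPowerRep hg
  have h2 := SymplecticExterior.conj_exteriorPowerRep (inv_mem hg)
  have hn' : n ≤ Module.finrank ℂ W := by omega
  refine le_antisymm ?_ fun u hu => ?_
  · rintro _ ⟨u, hu, rfl⟩
    exact SymplecticExterior.exteriorPower_apply_mem_of_normalizes Q hQ hQalt n hn' g h1 h2 U hU hu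
  · exact ⟨g.symm u, SymplecticExterior.exteriorPower_apply_mem_of_normalizes Q hQ hQalt n hn'
      g.symm h2 h1 U hU hu, g.apply_symm_apply u⟩
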